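/- Let $M$ be a connected smooth manifold (Hausdorff, second countable, finite-dimensional, without boundary) and let $(E,\rho_E,[\cdot,\cdot]_E)$ be a Lie algebroid over $M$: $E\to M$ is a smooth real vector bundle, the anchor $\rho_E:E\to TM$ is a smooth vector bundle morphism over $\mathrm{id}_M$, and $[\cdot,\cdot]_E$ is a real Lie bracket on the space $\Gamma(E)$ of smooth sections with $\rho_E([s_1,s_2]_E)=[\rho_E(s_1),\rho_E(s_2)]$ and $[s_1,fs_2]_E=f[s_1,s_2]_E+(\rho_E(s_1)f)\,s_2$ for all $s_1,s_2\in\Gamma(E)$, $f\in C^\infty(M)$. Assume that it is transitive, i.e. $\rho_E$ is surjective on every fibre, and that $\operatorname{rank}E=2m\ge 4$. Let $J_E$ be a smooth vector bundle endomorphism of $E$ over $\mathrm{id}_M$ with $J_E^2=-\mathrm{id}$, and let $g$ be a smooth Riemannian metric on $E$, such that $(E,J_E,g)$ is Kählerian, that is: (1) $g(J_Es_1,J_Es_2)=g(s_1,s_2)$; (2) $J_E$ is integrable: $[J_Es_1,J_Es_2]_E-J_E[s_1,J_Es_2]_E-J_E[J_Es_1,s_2]_E-[s_1,s_2]_E=0$;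 (3) the 2-form $\Phi(s_1,s_2)=g(s_1,J_Es_2)$ is closed for the Lie algebroid differential $d_E$, i.e. $$\rho_E(s_0)\Phi(s_1,s_2)-\rho_E(s_1)\Phi(s_0,s_2)+\rho_E(s_2)\Phi(s_0,s_1)-\Phi([s_0,s_1]_E,s_2)+\Phi([s_0,s_2]_E,s_1)-\Phi([s_1,s_2]_E,s_0)=0,$$ for all $s_0,s_1,s_2\in\Gamma(E)$. Let $D$ be the Levi-Civita connection of $g$ (the unique torsion-free linear connection on the Lie algebroid that is compatible with $g$), $R(s_1,s_2)s_3=D_{s_1}D_{s_2}s_3-D_{s_2}D_{s_1}s_3-D_{[s_1,s_2]_E}s_3$ its curvature, and $\mathcal R(s_1,s_2,s_3,s_4)=g(R(s_3,s_4)s_2,s_1)$. For a 2-plane $P\subset E_x$ with basis $\{s_1,s_2\}$ put $$K(P)=\frac{\mathcal R(s_1,s_2,s_1,s_2)}{g(s_1,s_1)g(s_2,s_2)-g(s_1,s_2)^2}.$$ The holomorphic sectional curvature is the restriction of $K$ to the $J_E$-invariant 2-planes. If for every $x\in M$ the value $K(P)$ is the same for all $J_E$-invariant 2-planes $P\subset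 E_x$, then $(E,J_E,g)$ has constant holomorphic sectional curvature: there is $c\in\mathbb R$ with $K(P)=c$ for every $x\in M$ and every $J_E$-invariant 2-plane $P\subset E_x$. -/

import Mathlib

open Bundle Module
open scoped Manifold ContDiff Topology

noncomputable section

set_option linter.unusedSectionVars false

namespace LieAlgd

variable {EM : Type*} [NormedAddCommGroup EM] [NormedSpace ℝ EM]
  {H : Type*} [TopologicalSpace H] {I : ModelWithCorners ℝ EM H}
  {M : Type*} [TopologicalSpace M] [ChartedSpace H M] [IsManifold I ∞ M]
  {F : Type*} [NormedAddCommGroup F] [NormedSpace ℝ F]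
  {E : M → Type*} [TopologicalSpace (TotalSpace F E)]
  [∀ x, AddCommGroup (E x)] [∀ x, Module ℝ (E x)] [∀ x, TopologicalSpace (E x)]
  [FiberBundle F E] [VectorBundle ℝ F E]

/-- The pointwise product of a smooth function and a smooth section. -/
def fsmul (f : C^∞⟮I, M; ℝ⟯) (s : Cₛ^∞⟮I; F, E⟯) : Cₛ^∞⟮I; F, E⟯ :=
  ⟨fun x => f x • s x, f.contMDiff.smul_section s.contMDiff⟩

variable (I F E) in
/-- A Lie algebroid structure on the smooth real vector bundle `E → M`: an anchor `ρ : E → TM`,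
which is a morphism of smooth vector bundles over the identity of `M`, and a real Lie algebra
structure on the space of smooth global sections, such that the anchor is a homomorphism to the
Lie algebra of vector fields and the Leibniz rule holds. -/
structure LieAlgebroid where
  /-- the anchor `ρ` on the fibres -/
  anchor : ∀ x, E x →L[ℝ] TangentSpace I x
  /-- the anchor is a smooth map of total spaces -/
  anchor_smooth : ContMDiff (I.prod 𝓘(ℝ, F)) I.tangent ∞
    (fun v : TotalSpace F E => (⟨v.proj, anchor v.proj v.snd⟩ : TangentBundle I M))
  /-- the bracket of smooth sections -/
  bracket : Cₛ^∞⟮I; F, E⟯ →ₗ[ℝ] Cₛ^∞⟮I; F, E⟯ →ₗ[ℝ] Cₛ^∞⟮I; F, E⟯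
  bracket_self : ∀ s, bracket s s = 0
  jacobi : ∀ s t u,
    bracket s (bracket t u) + bracket t (bracket u s) + bracket u (bracket s t) = 0
  anchor_bracket : ∀ s t x, anchor x (bracket s t x) =
    VectorField.mlieBracket I (fun y => anchor y (s y)) (fun y => anchor y (t y)) x
  leibniz : ∀ (s t : Cₛ^∞⟮I; F, E⟯) (f : C^∞⟮I, M; ℝ⟯) (x : M), bracket s (fsmul f t) x =
    f x • bracket s t x + mvfderiv I f x (anchor x (s x)) • t x

namespace LieAlgebroid

variable (A : LieAlgebroid I F E)

/-- The derivative `ρ(s) f` of a function `f` along the anchor of a section `s`. -/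
def deriv (s : Cₛ^∞⟮I; F, E⟯) (f : M → ℝ) (x : M) : ℝ :=
  mvfderiv I f x (A.anchor x (s x))

/-- A Lie algebroid is transitive if its anchor is surjective. -/
def IsTransitive : Prop := ∀ x, Function.Surjective (A.anchor x)

/-- The Lie algebroid differential `d_E` of a 2-cochain:
`ρ(s)Φ(t,u) - ρ(t)Φ(s,u) + ρ(u)Φ(s,t) - Φ([s,t],u) + Φ([s,u],t) - Φ([t,u],s)`. -/
def extDeriv₂ (Φ : Cₛ^∞⟮I; F, E⟯ → Cₛ^∞⟮I; F, E⟯ → M → ℝ) (s t u : Cₛ^∞⟮I; F, E⟯) (x : M) : ℝ :=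
  A.deriv s (Φ t u) x - A.deriv t (Φ s u) x + A.deriv u (Φ s t) x
    - Φ (A.bracket s t) u x + Φ (A.bracket s u) t x - Φ (A.bracket t u) s x

/-- A linear connection on a Lie algebroid. -/
structure LinearConnection where
  /-- the covariant derivative `∇_s t` -/
  toFun : Cₛ^∞⟮I; F, E⟯ →ₗ[ℝ] Cₛ^∞⟮I; F, E⟯ →ₗ[ℝ] Cₛ^∞⟮I; F, E⟯
  fsmul_left : ∀ (f : C^∞⟮I, M; ℝ⟯) (s t : Cₛ^∞⟮I; F, E⟯),
    toFun (fsmul f s) t = fsmul f (toFun s t)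
  leibniz : ∀ (f : C^∞⟮I, M; ℝ⟯) (s t : Cₛ^∞⟮I; F, E⟯) (x : M),
    toFun s (fsmul f t) x = A.deriv s f x • t x + f x • toFun s t x

variable {A} in
/-- The curvature `R(s,t)u = ∇_s ∇_t u - ∇_t ∇_s u - ∇_[s,t] u` of a linear connection. -/
def LinearConnection.curvature (D : A.LinearConnection) (s t u : Cₛ^∞⟮I; F, E⟯) :
    Cₛ^∞⟮I; F, E⟯ :=
  D.toFun s (D.toFun t u) - D.toFun t (D.toFun s u) - D.toFun (A.bracket s t) u

end LieAlgebroid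

section Metric


variable (g : ContMDiffRiemannianMetric I ∞ F E)

/-- The function `g(s, t)` for two smooth sections. -/
def metricFun (s t : Cₛ^∞⟮I; F, E⟯) (x : M) : ℝ := g.inner x (s x) (t x)

/-- The function `g(s,t)` is smooth. -/
theorem contMDiff_metricFun (s t : Cₛ^∞⟮I; F, E⟯) : ContMDiff I 𝓘(ℝ, ℝ) ∞ (metricFun g s t) := by
  intro x
  have := ContMDiffAt.clm_bundle_apply₂ (F₁ := F) (F₂ := F) (F₃ := ℝ) (E₃ := Bundle.Trivial M ℝ)
     (b := fun x : M => x) g.contMDiff.contMDiffAt (s.contMDiff x) (t.contMDiff x)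
  simp only [contMDiffAt_totalSpace] at this
  exact this.2

/-- A linear connection is a Levi-Civita connection of `g` if it is compatible with `g` and
torsion free. -/
structure LieAlgebroid.LinearConnection.IsLeviCivita {A : LieAlgebroid I F E}
    (D : A.LinearConnection) : Prop where
  metric : ∀ s t u x, A.deriv s (metricFun g t u) x =
    metricFun g (D.toFun s t) u x + metricFun g t (D.toFun s u) x
  torsion_free : ∀ s t, D.toFun s t - D.toFun t s - A.bracket s t = 0

end Metric

section Construction

variable [FiniteDimensional ℝ EM] [FiniteDimensional ℝ F] [T2Space M]
  [ContMDiffVectorBundle ∞ F E I]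


/-- Near each point there is a local frame consisting of smooth global sections, and every smooth
section has coefficients in it that extend to smooth functions on `M`. -/
theorem exists_frame (x₀ : M) : ∃ e : Fin (finrank ℝ F) → Cₛ^∞⟮I; F, E⟯,
    (∀ᶠ y in 𝓝 x₀, LinearIndependent ℝ (fun i => e i y) ∧
      ⊤ ≤ Submodule.span ℝ (Set.range fun i => e i y)) ∧
    ∀ s : Cₛ^∞⟮I; F, E⟯, ∃ c : Fin (finrank ℝ F) → C^∞⟮I, M; ℝ⟯,
      ∀ᶠ y in 𝓝 x₀, s y = ∑ i, c i y • e i y := by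
  have : ContMDiffVectorBundle 1 F E I := ContMDiffVectorBundle.of_le (n := ∞) (by norm_cast)
  let b := finBasis ℝ F
  let t := trivializationAt F E x₀
  have ht : t.baseSet ∈ 𝓝 x₀ :=
    t.open_baseSet.mem_nhds (FiberBundle.mem_baseSet_trivializationAt' x₀)
  obtain ⟨ψ, -, hψ⟩ := (SmoothBumpFunction.nhds_basis_tsupport (I := I) x₀).mem_iff.1 ht
  have h1 : ∀ᶠ y in 𝓝 x₀, ψ y = 1 := ψ.eventuallyEq_one
  have key := t.isLocalFrameOn_localFrame_baseSet I ∞ b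
  refine ⟨fun i => ⟨fun y => ψ y • t.localFrame b i y, ?_⟩, ?_, fun s => ?_⟩
  · exact ContMDiffOn.smul_section_of_tsupport ψ.contMDiff.contMDiffOn t.open_baseSet hψ
      (t.contMDiffOn_localFrame_baseSet ∞ b i)
  · filter_upwards [h1, ht] with y hy hyt
    simp only [ContMDiffSection.coeFn_mk, hy, one_smul]
    exact ⟨key.linearIndependent hyt, key.generating hyt⟩
  · refine ⟨fun i => ⟨fun y => ψ y * t.localFrameCoeff I b i y (s y), ?_⟩, ?_⟩
    · refine contMDiff_of_tsupport fun y hy => ?_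
      have hyt : y ∈ t.baseSet := hψ (tsupport_mul_subset_left hy)
      exact ψ.contMDiff.contMDiffAt.mul (contMDiffAt_localFrameCoeff b hyt (s.contMDiff y) i)
    · filter_upwards [h1, ht] with y hy hyt
      have := t.eq_sum_localFrameCoeff_smul (I := I) (s := s) (b := b) hyt
      simp only [ContMDiffSection.coeFn_mk, ContMDiffMap.coeFn_mk, hy, one_smul, one_mul]
      exact this


/-- Every vector is the value of a smooth global section. -/
theorem exists_section (x : M) (v : E x) : ∃ s : Cₛ^∞⟮I; F, E⟯, s x = v := by
  obtain ⟨e, he, -⟩ := exists_frame (I := I) (F := F) (E := E) x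
  obtain ⟨-, h⟩ := he.self_of_nhds
  obtain ⟨a, ha⟩ := (Submodule.mem_span_range_iff_exists_fun ℝ).1 (h (Submodule.mem_top (x := v)))
  refine ⟨∑ i, a i • e i, ?_⟩
  rw [← ha]
  exact (map_sum ((Pi.evalAddMonoidHom _ x).comp (ContMDiffSection.coeAddHom I F ∞ E)) _ _)

/-- A function-linear operator on sections only depends on the value of the section. -/
theorem eq_zero_of_tensorial (Φ : Cₛ^∞⟮I; F, E⟯ → M → ℝ)
    (hadd : ∀ s t x, Φ (s + t) x = Φ s x + Φ t x)
    (hsmul : ∀ f s x, Φ (fsmul f s) x = f x * Φ s x)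
    (s : Cₛ^∞⟮I; F, E⟯) (x : M) (hs : s x = 0) : Φ s x = 0 := by
  obtain ⟨e, he, hc⟩ := exists_frame (I := I) (F := F) (E := E) x
  obtain ⟨c, hc⟩ := hc s
  let Ψ : Cₛ^∞⟮I; F, E⟯ →+ ℝ := AddMonoidHom.mk' (fun s => Φ s x) fun s t => hadd s t x
  have hcoe : ∀ (u : Fin (finrank ℝ F) → Cₛ^∞⟮I; F, E⟯) y, (∑ i, u i) y = ∑ i, u i y := fun u y =>
    map_sum ((Pi.evalAddMonoidHom _ y).comp (ContMDiffSection.coeAddHom I F ∞ E)) _ _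
  -- the coefficients of `s` vanish at `x`
  have hc0 : ∀ i, c i x = 0 := by
    have h1 := hc.self_of_nhds
    rw [hs] at h1
    exact (Fintype.linearIndependent_iff.1 he.self_of_nhds.1) _ h1.symm
  set r := s - ∑ i, fsmul (c i) (e i) with hr
  have hr0 : ∀ᶠ y in 𝓝 x, r y = 0 := by
    filter_upwards [hc] with y hy
    rw [hr, ContMDiffSection.coe_sub, Pi.sub_apply, hcoe, hy]
    exact sub_self _
  obtain ⟨ψ, -, hψ⟩ := (SmoothBumpFunction.nhds_basis_tsupport (I := I) x).mem_iff.1 hr0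
  obtain ⟨f, hf⟩ : ∃ f : C^∞⟮I, M; ℝ⟯, ∀ y, f y = ψ y := ⟨⟨ψ, ψ.contMDiff⟩, fun _ => rfl⟩
  have hfr : fsmul f r = fsmul (0 : C^∞⟮I, M; ℝ⟯) r := by
    ext y
    change f y • r y = (0 : ℝ) • r y
    rw [hf]
    by_cases hy : ψ y = 0
    · rw [hy]
    · have : r y = 0 := hψ (subset_tsupport _ hy)
      rw [this, smul_zero, smul_zero]
  have h2 : Φ r x = 0 := by
    have h3 : Φ (fsmul f r) x = Φ (fsmul (0 : C^∞⟮I, M; ℝ⟯) r) x := by rw [hfr]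
    rwa [hsmul, hsmul, hf, ψ.eq_one, one_mul, ContMDiffMap.coe_zero, Pi.zero_apply,
      zero_mul] at h3
  have h4 : s = r + ∑ i, fsmul (c i) (e i) := by simp [hr]
  rw [h4, hadd, h2, zero_add]
  change Ψ _ = 0
  rw [map_sum]
  refine Finset.sum_eq_zero fun i _ => ?_
  change Φ _ x = 0
  rw [hsmul, hc0, zero_mul]

variable (g : ContMDiffRiemannianMetric I ∞ F E)

theorem metric_nondeg (x : M) (v : E x) (h : ∀ s : Cₛ^∞⟮I; F, E⟯, g.inner x v (s x) = 0) :
    v = 0 := by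
  obtain ⟨s, hs⟩ := exists_section (I := I) (F := F) x v
  by_contra hv
  have := g.pos x v hv
  have h' := h s
  rw [hs] at h'
  linarith

theorem section_ext_metric {s t : Cₛ^∞⟮I; F, E⟯}
    (h : ∀ u x, metricFun g s u x = metricFun g t u x) : s = t := by
  ext x
  refine sub_eq_zero.1 (metric_nondeg g x _ fun u => ?_)
  have := h u x
  simp only [metricFun] at this
  simp [this]

/-- The Riesz representation of a smooth 1-form on `E` by a smooth section. -/
theorem exists_riesz (Φ : Cₛ^∞⟮I; F, E⟯ → M → ℝ)
    (hadd : ∀ s t x, Φ (s + t) x = Φ s x + Φ t x)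
    (hsmul : ∀ f s x, Φ (fsmul f s) x = f x * Φ s x)
    (hsm : ∀ s, ContMDiff I 𝓘(ℝ, ℝ) ∞ (Φ s)) :
    ∃ t : Cₛ^∞⟮I; F, E⟯, ∀ s x, metricFun g t s x = Φ s x := by
  have hpt : ∀ x, ∃ v : E x, ∀ s, g.inner x v (s x) = Φ s x := by
    intro x
    have : FiniteDimensional ℝ (E x) := VectorBundle.finiteDimensional ℝ F E x
    let ev : Cₛ^∞⟮I; F, E⟯ →ₗ[ℝ] E x :=
      { toFun := fun s => s x, map_add' := fun _ _ => rfl, map_smul' := fun _ _ => rfl }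
    let Φx : Cₛ^∞⟮I; F, E⟯ →ₗ[ℝ] ℝ :=
      { toFun := fun s => Φ s x, map_add' := fun s t => hadd s t x
        map_smul' := fun a s => hsmul ⟨fun _ => a, contMDiff_const⟩ s x }
    obtain ⟨σ, hσ⟩ := ev.exists_rightInverse_of_surjective
      (LinearMap.range_eq_top.2 fun v => exists_section x v)
    let G : E x →ₗ[ℝ] Module.Dual ℝ (E x) :=
      { toFun := fun v => (g.inner x v : E x →ₗ[ℝ] ℝ)
        map_add' := fun _ _ => by ext; simp
        map_smul' := fun _ _ => by ext; simp }
    have hG : Function.Injective G := by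
      rw [injective_iff_map_eq_zero]
      intro v hv
      refine metric_nondeg g x v fun s => ?_
      exact LinearMap.congr_fun hv (s x)
    have hG' : Function.Surjective G :=
      (LinearMap.injective_iff_surjective_of_finrank_eq_finrank
        (Subspace.dual_finrank_eq).symm).1 hG
    obtain ⟨v, hv⟩ := hG' (Φx ∘ₗ σ)
    refine ⟨v, fun s => ?_⟩
    have h1 : g.inner x v (s x) = Φ (σ (s x)) x := LinearMap.congr_fun hv (s x)
    have h2 : (σ (s x) - s) x = 0 := by
      have := LinearMap.congr_fun hσ (s x)
      change (σ (s x)) x = s x at this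
      change (σ (s x)) x - s x = 0
      rw [this, sub_self]
    have h3 := eq_zero_of_tensorial Φ hadd hsmul _ x h2
    have h4 := hadd (σ (s x) - s) s x
    rw [sub_add_cancel, h3, zero_add] at h4
    rw [h1, h4]
  choose v hv using hpt
  have hsmooth : ContMDiff I (I.prod 𝓘(ℝ, F)) ∞ (fun x => TotalSpace.mk' F x (v x)) := by
    intro x
    obtain ⟨e, he, -⟩ := exists_frame (I := I) (F := F) (E := E) x
    let G : M → Matrix (Fin (finrank ℝ F)) (Fin (finrank ℝ F)) ℝ :=
      fun y => Matrix.of fun i j => metricFun g (e i) (e j) y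
    have hdet : ∀ N : M → Matrix (Fin (finrank ℝ F)) (Fin (finrank ℝ F)) ℝ,
        (∀ i j, ContMDiff I 𝓘(ℝ, ℝ) ∞ fun y => N y i j) →
        ContMDiff I 𝓘(ℝ, ℝ) ∞ fun y => (N y).det := by
      intro N hN
      simp only [Matrix.det_apply]
      refine contMDiff_finsetSum fun σ _ => ?_
      simp only [Units.smul_def, zsmul_eq_mul]
      exact contMDiff_const.mul (contMDiff_finsetProd fun i _ => hN _ _)
    have hGs : ∀ i j, ContMDiff I 𝓘(ℝ, ℝ) ∞ fun y => G y i j := fun i j =>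
      contMDiff_metricFun g (e i) (e j)
    have hGdet : ∀ᶠ y in 𝓝 x, (G y).det ≠ 0 := by
      filter_upwards [he] with y hy
      intro h0
      obtain ⟨w, hw, hGw⟩ := Matrix.exists_mulVec_eq_zero_iff.2 h0
      have h1 : ∀ i, g.inner y (e i y) (∑ j, w j • e j y) = 0 := fun i => by
        have := congrFun hGw i
        simp only [Matrix.mulVec, dotProduct, G, Matrix.of_apply, metricFun, Pi.zero_apply] at this
        simp only [map_sum, map_smul, smul_eq_mul]
        simpa only [mul_comm] using this
      have h2 : g.inner y (∑ j, w j • e j y) (∑ j, w j • e j y) = 0 := by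
        rw [g.symm, map_sum]
        refine Finset.sum_eq_zero fun i _ => ?_
        rw [map_smul, g.symm, h1, smul_zero]
      have h3 : ∑ j, w j • e j y = 0 := by
        by_contra h
        exact (g.pos y _ h).ne' h2
      exact hw (funext (Fintype.linearIndependent_iff.1 hy.1 w h3))
    let a : Fin (finrank ℝ F) → M → ℝ := fun i y =>
      ((G y).det)⁻¹ * ((G y).updateCol i fun k => Φ (e k) y).det
    have ha : ∀ i, ContMDiffAt I 𝓘(ℝ, ℝ) ∞ (a i) x := fun i => by
      refine ContMDiffAt.mul (((hdet G hGs) x).inv₀ hGdet.self_of_nhds) (hdet _ (fun k l => ?_) x)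
      by_cases hl : l = i
      · subst hl
        simpa using hsm (e k)
      · simpa [Matrix.updateCol_apply, hl] using hGs k l
    have hva : ∀ᶠ y in 𝓝 x, v y = ∑ i, a i y • e i y := by
      filter_upwards [he, hGdet] with y hy hd
      obtain ⟨c, hc⟩ :=
        (Submodule.mem_span_range_iff_exists_fun ℝ).1 (hy.2 (Submodule.mem_top (x := v y)))
      have h1 : (G y).mulVec c = fun k => Φ (e k) y := by
        funext k
        rw [← hv y (e k), g.symm, ← hc]
        simp only [map_sum, map_smul, smul_eq_mul, Matrix.mulVec, dotProduct, G, Matrix.of_apply,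
          metricFun]
        exact Finset.sum_congr rfl fun _ _ => mul_comm _ _
      have h2 : ∀ i, a i y = c i := fun i => by
        have h3 : (G y).cramer (fun k => Φ (e k) y) i = (G y).det * c i := by
          rw [← h1, Matrix.cramer_eq_adjugate_mulVec, Matrix.mulVec_mulVec, Matrix.adjugate_mul,
            Matrix.smul_mulVec, Matrix.one_mulVec, Pi.smul_apply, smul_eq_mul]
        rw [Matrix.cramer_apply] at h3
        simp only [a, h3]
        exact inv_mul_cancel_left₀ hd _
      rw [← hc]
      exact Finset.sum_congr rfl fun i _ => by rw [h2]
    have hs : ContMDiffAt I (I.prod 𝓘(ℝ, F)) ∞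
        (fun y => TotalSpace.mk' F y (∑ i, a i y • e i y)) x :=
      ContMDiffAt.sum_section fun i _ => (ha i).smul_section ((e i).contMDiff x)
    refine hs.congr_of_eventuallyEq ?_
    filter_upwards [hva] with y hy
    rw [hy]
  exact ⟨⟨v, hsmooth⟩, fun s x => hv x s⟩


end Construction

section Calculus

variable (g : ContMDiffRiemannianMetric I ∞ F E)


theorem metricFun_comm (s t : Cₛ^∞⟮I; F, E⟯) : metricFun g s t = metricFun g t s :=
  funext fun x => g.symm x _ _

theorem metricFun_add_left (s t u : Cₛ^∞⟮I; F, E⟯) :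
    metricFun g (s + t) u = metricFun g s u + metricFun g t u := by
  funext x; simp [metricFun]

theorem metricFun_add_right (s t u : Cₛ^∞⟮I; F, E⟯) :
    metricFun g s (t + u) = metricFun g s t + metricFun g s u := by
  funext x; simp [metricFun]

theorem metricFun_sub_left (s t u : Cₛ^∞⟮I; F, E⟯) :
    metricFun g (s - t) u = metricFun g s u - metricFun g t u := by
  funext x; simp [metricFun]

theorem metricFun_fsmul_left (f : C^∞⟮I, M; ℝ⟯) (s t : Cₛ^∞⟮I; F, E⟯) :
    metricFun g (fsmul f s) t = f * metricFun g s t := by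
  funext x; simp [metricFun, fsmul]

theorem metricFun_fsmul_right (f : C^∞⟮I, M; ℝ⟯) (s t : Cₛ^∞⟮I; F, E⟯) :
    metricFun g s (fsmul f t) = f * metricFun g s t := by
  funext x; simp [metricFun, fsmul]

theorem const_smul_eq_fsmul (c : ℝ) (s : Cₛ^∞⟮I; F, E⟯) :
    c • s = fsmul (ContMDiffMap.const c) s := rfl

theorem fsmul_apply (f : C^∞⟮I, M; ℝ⟯) (s : Cₛ^∞⟮I; F, E⟯) (x : M) :
    fsmul f s x = f x • s x := rfl

end Calculus

namespace LieAlgebroid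

variable (A : LieAlgebroid I F E) (g : ContMDiffRiemannianMetric I ∞ F E)

theorem bracket_skew (s t : Cₛ^∞⟮I; F, E⟯) : A.bracket s t = -A.bracket t s := by
  have h := A.bracket_self (s + t)
  simp only [map_add, LinearMap.add_apply, A.bracket_self, zero_add, add_zero] at h
  rw [eq_neg_iff_add_eq_zero, add_comm]
  exact h

theorem deriv_add (s : Cₛ^∞⟮I; F, E⟯) {f h : M → ℝ} (hf : ContMDiff I 𝓘(ℝ, ℝ) ∞ f)
    (hh : ContMDiff I 𝓘(ℝ, ℝ) ∞ h) : A.deriv s (f + h) = A.deriv s f + A.deriv s h := by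
  funext x
  simp [deriv, mvfderiv_add (hf.mdifferentiableAt (by simp) (x := x))
    (hh.mdifferentiableAt (by simp))]

theorem deriv_mul (s : Cₛ^∞⟮I; F, E⟯) {f h : M → ℝ} (hf : ContMDiff I 𝓘(ℝ, ℝ) ∞ f)
    (hh : ContMDiff I 𝓘(ℝ, ℝ) ∞ h) :
    A.deriv s (f * h) = A.deriv s f * h + f * A.deriv s h := by
  funext x
  simp [deriv, mvfderiv_mul (hf.mdifferentiableAt (by simp) (x := x))
    (hh.mdifferentiableAt (by simp))]
  ring

theorem deriv_const (s : Cₛ^∞⟮I; F, E⟯) (c : ℝ) : A.deriv s (fun _ => c) = 0 := by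
  funext x
  simp [deriv, mvfderiv_const]

theorem deriv_add_section (s t : Cₛ^∞⟮I; F, E⟯) (f : M → ℝ) :
    A.deriv (s + t) f = A.deriv s f + A.deriv t f := by
  funext x; simp [deriv]

theorem deriv_fsmul_section (f : C^∞⟮I, M; ℝ⟯) (s : Cₛ^∞⟮I; F, E⟯) (h : M → ℝ) :
    A.deriv (fsmul f s) h = f * A.deriv s h := by
  funext x; simp [deriv, fsmul]

theorem contMDiff_deriv (s : Cₛ^∞⟮I; F, E⟯) {f : M → ℝ} (hf : ContMDiff I 𝓘(ℝ, ℝ) ∞ f) :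
    ContMDiff I 𝓘(ℝ, ℝ) ∞ (A.deriv s f) := by
  have h1 : ContMDiff I I.tangent ∞
      (fun x => (⟨x, A.anchor x (s x)⟩ : TangentBundle I M)) := A.anchor_smooth.comp s.contMDiff
  have h2 : ContMDiff I 𝓘(ℝ, ℝ).tangent ∞
      (fun x => tangentMap I 𝓘(ℝ, ℝ) f ⟨x, A.anchor x (s x)⟩) :=
    (hf.contMDiff_tangentMap (m := ∞) (by simp)).comp h1
  exact contMDiff_snd_tangentBundle_modelSpace ℝ 𝓘(ℝ, ℝ) |>.comp h2

theorem metricFun_bracket_fsmul_right (f : C^∞⟮I, M; ℝ⟯) (s t u : Cₛ^∞⟮I; F, E⟯) :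
    metricFun g (A.bracket s (fsmul f t)) u =
      f * metricFun g (A.bracket s t) u + A.deriv s f * metricFun g t u := by
  funext x
  simp [metricFun, A.leibniz, deriv]

theorem metricFun_bracket_fsmul_left (f : C^∞⟮I, M; ℝ⟯) (s t u : Cₛ^∞⟮I; F, E⟯) :
    metricFun g (A.bracket (fsmul f s) t) u =
      f * metricFun g (A.bracket s t) u - A.deriv t f * metricFun g s u := by
  funext x
  rw [A.bracket_skew, A.bracket_skew s t]
  simp [metricFun, A.leibniz, deriv]
  ring

/-- The right-hand side of the Koszul formula for `2 g(∇_s t, u)`. -/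
def koszul (s t u : Cₛ^∞⟮I; F, E⟯) : M → ℝ :=
  A.deriv s (metricFun g t u) + A.deriv t (metricFun g s u) - A.deriv u (metricFun g s t)
    + metricFun g (A.bracket u s) t + metricFun g (A.bracket u t) s
    + metricFun g (A.bracket s t) u

theorem contMDiff_koszul (s t u : Cₛ^∞⟮I; F, E⟯) :
    ContMDiff I 𝓘(ℝ, ℝ) ∞ (A.koszul g s t u) := by
  have h1 := fun s t u : Cₛ^∞⟮I; F, E⟯ => A.contMDiff_deriv s (contMDiff_metricFun g t u)
  have h2 := fun s t : Cₛ^∞⟮I; F, E⟯ => contMDiff_metricFun g s t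
  exact (((((h1 s t u).add (h1 t s u)).sub (h1 u s t)).add (h2 _ _)).add (h2 _ _)).add (h2 _ _)

theorem koszul_add₁ (s s' t u : Cₛ^∞⟮I; F, E⟯) :
    A.koszul g (s + s') t u = A.koszul g s t u + A.koszul g s' t u := by
  simp only [koszul, metricFun_add_left, metricFun_add_right, deriv_add_section, map_add,
    LinearMap.add_apply, A.deriv_add _ (contMDiff_metricFun g _ _) (contMDiff_metricFun g _ _)]
  ring

theorem koszul_add₂ (s t t' u : Cₛ^∞⟮I; F, E⟯) :
    A.koszul g s (t + t') u = A.koszul g s t u + A.koszul g s t' u := by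
  simp only [koszul, metricFun_add_left, metricFun_add_right, deriv_add_section, map_add,
    A.deriv_add _ (contMDiff_metricFun g _ _) (contMDiff_metricFun g _ _)]
  ring

theorem koszul_add₃ (s t u u' : Cₛ^∞⟮I; F, E⟯) :
    A.koszul g s t (u + u') = A.koszul g s t u + A.koszul g s t u' := by
  simp only [koszul, metricFun_add_left, metricFun_add_right, deriv_add_section, map_add,
    LinearMap.add_apply, A.deriv_add _ (contMDiff_metricFun g _ _) (contMDiff_metricFun g _ _)]
  ring

theorem koszul_fsmul₁ (f : C^∞⟮I, M; ℝ⟯) (s t u : Cₛ^∞⟮I; F, E⟯) :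
    A.koszul g (fsmul f s) t u = f * A.koszul g s t u := by
  simp only [koszul, metricFun_fsmul_left, metricFun_fsmul_right, deriv_fsmul_section,
    metricFun_bracket_fsmul_left, metricFun_bracket_fsmul_right,
    A.deriv_mul _ f.contMDiff (contMDiff_metricFun g _ _)]
  ring

theorem koszul_fsmul₂ (f : C^∞⟮I, M; ℝ⟯) (s t u : Cₛ^∞⟮I; F, E⟯) :
    A.koszul g s (fsmul f t) u = f * A.koszul g s t u + 2 * (A.deriv s f * metricFun g t u) := by
  simp only [koszul, metricFun_fsmul_left, metricFun_fsmul_right, deriv_fsmul_section,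
    metricFun_bracket_fsmul_right,
    A.deriv_mul _ f.contMDiff (contMDiff_metricFun g _ _), metricFun_comm g t s]
  ring

theorem koszul_fsmul₃ (f : C^∞⟮I, M; ℝ⟯) (s t u : Cₛ^∞⟮I; F, E⟯) :
    A.koszul g s t (fsmul f u) = f * A.koszul g s t u := by
  simp only [koszul, metricFun_fsmul_right, deriv_fsmul_section,
    metricFun_bracket_fsmul_left,
    A.deriv_mul _ f.contMDiff (contMDiff_metricFun g _ _), metricFun_comm g u s,
    metricFun_comm g u t]
  ring

/-- The function `ρ(s) f` as a bundled smooth function. -/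
def derivC (s : Cₛ^∞⟮I; F, E⟯) (f : C^∞⟮I, M; ℝ⟯) : C^∞⟮I, M; ℝ⟯ :=
  ⟨A.deriv s f, A.contMDiff_deriv s f.contMDiff⟩

theorem derivC_apply (s : Cₛ^∞⟮I; F, E⟯) (f : C^∞⟮I, M; ℝ⟯) (x : M) :
    A.derivC s f x = A.deriv s f x := rfl

theorem coe_derivC (s : Cₛ^∞⟮I; F, E⟯) (f : C^∞⟮I, M; ℝ⟯) :
    (A.derivC s f : M → ℝ) = A.deriv s f := rfl

theorem bracket_fsmul (s t : Cₛ^∞⟮I; F, E⟯) (f : C^∞⟮I, M; ℝ⟯) :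
    A.bracket s (fsmul f t) = fsmul f (A.bracket s t) + fsmul (A.derivC s f) t :=
  ContMDiffSection.ext fun x => A.leibniz s t f x

/-- Where a section does not vanish, `[ρ(s), ρ(t)] = ρ([s, t])` as derivations. -/
theorem deriv_comm_smul (s t u : Cₛ^∞⟮I; F, E⟯) (f : C^∞⟮I, M; ℝ⟯) (x : M) :
    (A.deriv s (A.deriv t f) x - A.deriv t (A.deriv s f) x - A.deriv (A.bracket s t) f x) • u x
      = 0 := by
  have jac : ∀ a b c, A.bracket (A.bracket a b) c =
      A.bracket a (A.bracket b c) - A.bracket b (A.bracket a c) := by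
    intro a b c
    have := A.jacobi a b c
    rw [A.bracket_skew c (A.bracket a b), A.bracket_skew c a, map_neg] at this
    rw [← sub_eq_zero, ← neg_eq_zero, ← this]
    abel
  have h1 := congrArg (fun w : Cₛ^∞⟮I; F, E⟯ => w x) (jac s t (fsmul f u))
  have h2 := congrArg (fun w : Cₛ^∞⟮I; F, E⟯ => f x • w x) (jac s t u)
  simp only [bracket_fsmul, map_add, ContMDiffSection.coe_add, ContMDiffSection.coe_sub,
    Pi.add_apply, Pi.sub_apply, fsmul_apply, derivC_apply, coe_derivC] at h1 h2
  rw [h2] at h1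
  rw [sub_smul, sub_smul, ← sub_eq_zero.2 h1.symm]
  module

theorem connection_fsmul (s t : Cₛ^∞⟮I; F, E⟯) (D : A.LinearConnection) (f : C^∞⟮I, M; ℝ⟯) :
    D.toFun s (fsmul f t) = fsmul (A.derivC s f) t + fsmul f (D.toFun s t) :=
  ContMDiffSection.ext fun x => D.leibniz f s t x

variable [FiniteDimensional ℝ EM] [FiniteDimensional ℝ F] [T2Space M]
  [ContMDiffVectorBundle ∞ F E I]

/-- Existence of the Levi-Civita connection. -/
theorem exists_isLeviCivita : ∃ D : A.LinearConnection, D.IsLeviCivita g := by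
  have h : ∀ s t : Cₛ^∞⟮I; F, E⟯, ∃ w : Cₛ^∞⟮I; F, E⟯, ∀ u x,
      metricFun g w u x = 2⁻¹ * A.koszul g s t u x := by
    intro s t
    refine exists_riesz g (fun u x => 2⁻¹ * A.koszul g s t u x) ?_ ?_ ?_
    · intro u u' x
      simp only [koszul_add₃, Pi.add_apply]; ring
    · intro f u x
      simp only [koszul_fsmul₃, Pi.mul_apply]; ring
    · intro u
      exact contMDiff_const.mul (A.contMDiff_koszul g s t u)
  choose D hD using h
  have hfl : ∀ (f : C^∞⟮I, M; ℝ⟯) (s t : Cₛ^∞⟮I; F, E⟯), D (fsmul f s) t = fsmul f (D s t) := by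
    intro f s t
    refine section_ext_metric g fun u x => ?_
    simp only [metricFun_fsmul_left, Pi.mul_apply, hD, koszul_fsmul₁]; ring
  have hfr : ∀ (f : C^∞⟮I, M; ℝ⟯) (s t u : Cₛ^∞⟮I; F, E⟯) x,
      metricFun g (D s (fsmul f t)) u x =
        A.deriv s f x * metricFun g t u x + f x * metricFun g (D s t) u x := by
    intro f s t u x
    simp only [Pi.mul_apply, Pi.add_apply, hD, koszul_fsmul₂, Pi.ofNat_apply]; ring
  let D' : A.LinearConnection :=
    { toFun := LinearMap.mk₂ ℝ D
        (fun s s' t => section_ext_metric g fun u x => by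
          simp only [metricFun_add_left, Pi.add_apply, hD, koszul_add₁]; ring)
        (fun c s t => by simp only [const_smul_eq_fsmul, hfl])
        (fun s t t' => section_ext_metric g fun u x => by
          simp only [metricFun_add_left, Pi.add_apply, hD, koszul_add₂]; ring)
        (fun c s t => section_ext_metric g fun u x => by
          have : A.deriv s (ContMDiffMap.const c : C^∞⟮I, M; ℝ⟯) x = 0 :=
            congrFun (A.deriv_const s c) x
          simp only [const_smul_eq_fsmul, hfr, metricFun_fsmul_left, Pi.mul_apply, this]; ring)
      fsmul_left := hfl
      leibniz := fun f s t x => by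
        refine sub_eq_zero.1 (metric_nondeg g x _ fun u => ?_)
        have := hfr f s t u x
        simp only [metricFun] at this
        change g.inner x (D s (fsmul f t) x - (A.deriv s f x • t x + f x • D s t x)) (u x) = 0
        simp only [map_sub, map_add, map_smul, sub_apply, add_apply, smul_apply, smul_eq_mul, this]
        ring }
  have hD' : ∀ s t u x, metricFun g (D'.toFun s t) u x = 2⁻¹ * A.koszul g s t u x := hD
  refine ⟨D', ⟨fun s t u x => ?_, fun s t => section_ext_metric g fun u x => ?_⟩⟩
  · rw [metricFun_comm g t (D'.toFun s u), hD', hD']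
    simp only [koszul, Pi.add_apply, Pi.sub_apply]
    rw [metricFun_comm g u t, A.bracket_skew t s, A.bracket_skew u s, A.bracket_skew u t]
    simp only [metricFun, ContMDiffSection.coe_neg, Pi.neg_apply, map_neg, neg_apply]
    ring
  · simp only [metricFun_sub_left, Pi.sub_apply, hD', koszul, Pi.add_apply]
    rw [metricFun_comm g t s, A.bracket_skew t s]
    simp only [metricFun, ContMDiffSection.coe_neg, Pi.neg_apply, map_neg, neg_apply,
      ContMDiffSection.coe_zero, Pi.zero_apply, map_zero, zero_apply]
    ring

/-- Uniqueness of the Levi-Civita connection. -/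
theorem isLeviCivita_unique {D D' : A.LinearConnection} (hD : D.IsLeviCivita g)
    (hD' : D'.IsLeviCivita g) : D = D' := by
  have key : ∀ {D : A.LinearConnection}, D.IsLeviCivita g → ∀ s t u x,
      metricFun g (D.toFun s t) u x = 2⁻¹ * A.koszul g s t u x := by
    intro D hD s t u x
    have h : ∀ a b : Cₛ^∞⟮I; F, E⟯, A.bracket a b = D.toFun a b - D.toFun b a := fun a b =>
      (sub_eq_zero.1 (hD.torsion_free a b)).symm
    simp only [koszul, Pi.add_apply, Pi.sub_apply, hD.metric, h, metricFun_sub_left]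
    rw [metricFun_comm g t (D.toFun s u), metricFun_comm g s (D.toFun t u),
      metricFun_comm g s (D.toFun u t)]
    ring
  have : D.toFun = D'.toFun := LinearMap.ext fun s => LinearMap.ext fun t =>
    section_ext_metric g fun u x => by rw [key hD, key hD']
  cases D; cases D'; congr

/-- The Levi-Civita connection of a Riemannian metric on a Lie algebroid: the unique
torsion free linear connection compatible with the metric. -/
def leviCivita : A.LinearConnection := Classical.choose (A.exists_isLeviCivita g)

theorem leviCivita_spec : (A.leviCivita g).IsLeviCivita g :=
  Classical.choose_spec (A.exists_isLeviCivita g)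


/-- The Riemann curvature tensor `𝓡(s₁, s₂, s₃, s₄) = g(R(s₃, s₄) s₂, s₁)` of the Levi-Civita
connection. -/
def riemann (s₁ s₂ s₃ s₄ : Cₛ^∞⟮I; F, E⟯) (x : M) : ℝ :=
  metricFun g ((A.leviCivita g).curvature s₃ s₄ s₂) s₁ x

/-- The sectional curvature of the frame given by the values of two sections at `x`:
`𝓡(s, t, s, t) / (g(s,s) g(t,t) - g(s,t)²)`. -/
def frameCurvature (s t : Cₛ^∞⟮I; F, E⟯) (x : M) : ℝ :=
  A.riemann g s t s t x /
    (metricFun g s s x * metricFun g t t x - metricFun g s t x ^ 2)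

open scoped Classical in
/-- The sectional curvature `K(P)` in the direction of a 2-plane `P` of the fibre `E x`, computed
in a frame of `P` given by the values at `x` of two sections. It does not depend on the frame, see
`sectionalCurvature_eq`. (Junk value `0` if `P` is not a 2-plane.) -/
def sectionalCurvature (x : M) (P : Submodule ℝ (E x)) : ℝ :=
  if h : ∃ p : Cₛ^∞⟮I; F, E⟯ × Cₛ^∞⟮I; F, E⟯,
      LinearIndependent ℝ ![p.1 x, p.2 x] ∧ Submodule.span ℝ {p.1 x, p.2 x} = P
  then A.frameCurvature g h.choose.1 h.choose.2 x else 0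

/-! ### Independence of the frame -/

variable (s t u w : Cₛ^∞⟮I; F, E⟯)

/-- `g(R(s,t)u, w)`. -/
theorem riemann_eq (x : M) : A.riemann g w u s t x =
    metricFun g ((A.leviCivita g).toFun s ((A.leviCivita g).toFun t u)) w x
      - metricFun g ((A.leviCivita g).toFun t ((A.leviCivita g).toFun s u)) w x
      - metricFun g ((A.leviCivita g).toFun (A.bracket s t) u) w x := by
  simp only [riemann, LinearConnection.curvature, metricFun_sub_left, Pi.sub_apply]

theorem riemann_swap₃₄ (x : M) : A.riemann g w u t s x = -A.riemann g w u s t x := by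
  rw [riemann_eq, riemann_eq, A.bracket_skew t s]
  simp only [map_neg, LinearMap.neg_apply, metricFun, ContMDiffSection.coe_neg, Pi.neg_apply,
    neg_apply]
  ring

theorem riemann_self (x : M) : A.riemann g u u s t x = 0 := by
  by_cases hu : u x = 0
  · simp [riemann, metricFun, hu]
  have hm := (A.leviCivita_spec g).metric
  set D := A.leviCivita g with hD
  let f : C^∞⟮I, M; ℝ⟯ := ⟨metricFun g u u, contMDiff_metricFun g u u⟩
  have h := (smul_eq_zero.1 (A.deriv_comm_smul s t u f x)).resolve_right hu
  have h1 : ∀ a : Cₛ^∞⟮I; F, E⟯, A.deriv a (metricFun g u u) =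
      metricFun g (D.toFun a u) u + metricFun g (D.toFun a u) u := fun a => by
    funext y; rw [hm, metricFun_comm g u (D.toFun a u)]; rfl
  change A.deriv s (A.deriv t (metricFun g u u)) x - A.deriv t (A.deriv s (metricFun g u u)) x
    - A.deriv (A.bracket s t) (metricFun g u u) x = 0 at h
  simp only [h1, A.deriv_add _ (contMDiff_metricFun g _ _) (contMDiff_metricFun g _ _),
    Pi.add_apply, hm] at h
  rw [metricFun_comm g (D.toFun t u) (D.toFun s u),
    metricFun_comm g u (D.toFun (A.bracket s t) u)] at h
  rw [riemann_eq, ← hD]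
  linarith

theorem riemann_add₁ (w' : Cₛ^∞⟮I; F, E⟯) (x : M) :
    A.riemann g (w + w') u s t x = A.riemann g w u s t x + A.riemann g w' u s t x := by
  simp only [riemann, metricFun_add_right, Pi.add_apply]

theorem riemann_add₂ (u' : Cₛ^∞⟮I; F, E⟯) (x : M) :
    A.riemann g w (u + u') s t x = A.riemann g w u s t x + A.riemann g w u' s t x := by
  simp only [riemann_eq, map_add, metricFun_add_left, Pi.add_apply]
  ring

theorem riemann_add₃ (s' : Cₛ^∞⟮I; F, E⟯) (x : M) :
    A.riemann g w u (s + s') t x = A.riemann g w u s t x + A.riemann g w u s' t x := by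
  simp only [riemann_eq, map_add, LinearMap.add_apply, metricFun_add_left, Pi.add_apply]
  ring

theorem riemann_add₄ (t' : Cₛ^∞⟮I; F, E⟯) (x : M) :
    A.riemann g w u s (t + t') x = A.riemann g w u s t x + A.riemann g w u s t' x := by
  simp only [riemann_eq, map_add, LinearMap.add_apply, metricFun_add_left, Pi.add_apply]
  ring

theorem riemann_swap₁₂ (x : M) : A.riemann g u w s t x = -A.riemann g w u s t x := by
  have h := A.riemann_self g s t (u + w) x
  rw [riemann_add₁, riemann_add₂, riemann_add₂, riemann_self, riemann_self] at h
  linarith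

theorem riemann_fsmul₁ (f : C^∞⟮I, M; ℝ⟯) (x : M) :
    A.riemann g (fsmul f w) u s t x = f x * A.riemann g w u s t x := by
  simp only [riemann, metricFun_fsmul_right, Pi.mul_apply]

theorem riemann_fsmul₂ (f : C^∞⟮I, M; ℝ⟯) (x : M) :
    A.riemann g w (fsmul f u) s t x = f x * A.riemann g w u s t x := by
  rw [riemann_swap₁₂, riemann_fsmul₁, A.riemann_swap₁₂ g s t w u]
  ring

theorem riemann_fsmul₄ (f : C^∞⟮I, M; ℝ⟯) (x : M) :
    A.riemann g w u s (fsmul f t) x = f x * A.riemann g w u s t x := by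
  simp only [riemann_eq, bracket_fsmul, connection_fsmul, (A.leviCivita g).fsmul_left, map_add,
    LinearMap.add_apply, metricFun_add_left, metricFun_fsmul_left, Pi.add_apply, Pi.mul_apply]
  ring

theorem riemann_fsmul₃ (f : C^∞⟮I, M; ℝ⟯) (x : M) :
    A.riemann g w u (fsmul f s) t x = f x * A.riemann g w u s t x := by
  rw [riemann_swap₃₄, riemann_fsmul₄, A.riemann_swap₃₄ g s t u w]
  ring

variable {s t}

theorem frameCurvature_of_eq_combination {s' t' : Cₛ^∞⟮I; F, E⟯} {x : M} {a b c d : ℝ}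
    (hs : s' x = a • s x + b • t x) (ht : t' x = c • s x + d • t x) (hd : a * d - b * c ≠ 0) :
    A.frameCurvature g s' t' x = A.frameCurvature g s t x := by
  have e₁ : ∀ (r r' : Cₛ^∞⟮I; F, E⟯) u p q, r x = r' x →
      A.riemann g r u p q x = A.riemann g r' u p q x := fun r r' u p q h => by
    have : A.riemann g (r - r') u p q x = 0 :=
      eq_zero_of_tensorial (fun r => A.riemann g r u p q)
      (fun r r' y => A.riemann_add₁ g p q u r r' y) (fun f r y => A.riemann_fsmul₁ g p q u r f y)
      (r - r') x (by simp [h])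
    have h2 := A.riemann_add₁ g p q u (r - r') r' x
    rw [sub_add_cancel] at h2
    rw [h2, this, zero_add]
  have e₃ : ∀ (r r' : Cₛ^∞⟮I; F, E⟯) v u q, r x = r' x →
      A.riemann g v u r q x = A.riemann g v u r' q x := fun r r' v u q h => by
    have : A.riemann g v u (r - r') q x = 0 :=
      eq_zero_of_tensorial (fun r => A.riemann g v u r q)
      (fun r r' y => A.riemann_add₃ g r q u v r' y) (fun f r y => A.riemann_fsmul₃ g r q u v f y)
      (r - r') x (by simp [h])
    have h2 := A.riemann_add₃ g (r - r') q u v r' x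
    rw [sub_add_cancel] at h2
    rw [h2, this, zero_add]
  have e : ∀ (s' t' : Cₛ^∞⟮I; F, E⟯), s' x = (a • s + b • t) x → t' x = (c • s + d • t) x →
      A.riemann g s' t' s' t' x =
        A.riemann g (a • s + b • t) (c • s + d • t) (a • s + b • t) (c • s + d • t) x := by
    intro s' t' hs ht
    rw [e₁ _ _ _ _ _ hs, riemann_swap₁₂, e₁ _ _ _ _ _ ht, ← riemann_swap₁₂, e₃ _ _ _ _ _ hs,
      riemann_swap₃₄, e₃ _ _ _ _ _ ht, ← riemann_swap₃₄]
  have hc : ∀ (k : ℝ), (ContMDiffMap.const k : C^∞⟮I, M; ℝ⟯) x = k := fun _ => rfl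
  have hn : A.riemann g s' t' s' t' x = (a * d - b * c) ^ 2 * A.riemann g s t s t x := by
    rw [e s' t' hs ht]
    simp only [riemann_add₁, riemann_add₂, riemann_add₃, riemann_add₄, const_smul_eq_fsmul,
      riemann_fsmul₁, riemann_fsmul₂, riemann_fsmul₃, riemann_fsmul₄, hc, riemann_self]
    have z : ∀ p q r, A.riemann g p q r r x = 0 := fun p q r => by
      have := A.riemann_swap₃₄ g r r q p x
      linarith
    simp only [z, A.riemann_swap₁₂ g _ _ s t, A.riemann_swap₃₄ g s t]
    ring
  have hg : metricFun g s' s' x * metricFun g t' t' x - metricFun g s' t' x ^ 2 =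
      (a * d - b * c) ^ 2 *
        (metricFun g s s x * metricFun g t t x - metricFun g s t x ^ 2) := by
    simp only [metricFun, hs, ht, map_add, map_smul, add_apply, smul_apply, smul_eq_mul,
      g.symm x (t x) (s x)]
    ring
  rw [frameCurvature, frameCurvature, hn, hg, mul_div_mul_left _ _ (pow_ne_zero 2 hd)]

/-- The sectional curvature may be computed in any frame of the 2-plane. -/
theorem sectionalCurvature_eq (x : M) (hst : LinearIndependent ℝ ![s x, t x]) :
    A.sectionalCurvature g x (Submodule.span ℝ {s x, t x}) = A.frameCurvature g s t x := by
  have h : ∃ p : Cₛ^∞⟮I; F, E⟯ × Cₛ^∞⟮I; F, E⟯, LinearIndependent ℝ ![p.1 x, p.2 x] ∧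
      Submodule.span ℝ {p.1 x, p.2 x} = Submodule.span ℝ {s x, t x} := ⟨(s, t), hst, rfl⟩
  rw [sectionalCurvature, dif_pos h]
  obtain ⟨hli, hspan⟩ := h.choose_spec
  set s' := h.choose.1
  set t' := h.choose.2
  obtain ⟨a, b, hs⟩ := Submodule.mem_span_pair.1
    (hspan ▸ Submodule.subset_span (Set.mem_insert (s' x) _))
  obtain ⟨c, d, ht⟩ := Submodule.mem_span_pair.1
    (hspan ▸ Submodule.subset_span (Set.mem_insert_of_mem (s' x) (Set.mem_singleton (t' x))))
  refine A.frameCurvature_of_eq_combination g hs.symm ht.symm fun h0 => ?_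
  have h1 : d • s' x + (-b) • t' x = 0 := by
    have : d • (a • s x + b • t x) + (-b) • (c • s x + d • t x) = (a * d - b * c) • s x := by module
    rw [← hs, ← ht, this, h0, zero_smul]
  have h2 : (-c) • s' x + a • t' x = 0 := by
    have : (-c) • (a • s x + b • t x) + a • (c • s x + d • t x) = (a * d - b * c) • t x := by module
    rw [← hs, ← ht, this, h0, zero_smul]
  have k1 := LinearIndependent.pair_iff.1 hli _ _ h1
  have k2 := LinearIndependent.pair_iff.1 hli _ _ h2
  have hs0 : s' x = 0 := by
    rw [← hs, k2.2, neg_eq_zero.1 k1.2]; simp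
  exact hli.ne_zero 0 hs0

end LieAlgebroid

variable (F E) in
/-- An almost complex structure on the smooth real vector bundle `E`: a smooth vector bundle
endomorphism `J` over the identity with `J² = -1`. -/
structure AlmostComplexStructure (I : ModelWithCorners ℝ EM H) where
  /-- the endomorphism on the fibres -/
  toFun : ∀ x, E x →L[ℝ] E x
  smooth : ContMDiff (I.prod 𝓘(ℝ, F)) (I.prod 𝓘(ℝ, F)) ∞
    (fun v : TotalSpace F E => TotalSpace.mk' F v.proj (toFun v.proj v.snd))
  sq : ∀ x v, toFun x (toFun x v) = -v

namespace AlmostComplexStructure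

variable (J : AlmostComplexStructure F E I)

/-- The action of an almost complex structure on smooth sections. -/
def onSection (s : Cₛ^∞⟮I; F, E⟯) : Cₛ^∞⟮I; F, E⟯ :=
  ⟨fun x => J.toFun x (s x), J.smooth.comp s.contMDiff⟩

/-- The Nijenhuis tensor `[Js,Jt] - J[s,Jt] - J[Js,t] - [s,t]`. -/
def nijenhuis (A : LieAlgebroid I F E) (s t : Cₛ^∞⟮I; F, E⟯) : Cₛ^∞⟮I; F, E⟯ :=
  A.bracket (J.onSection s) (J.onSection t) - J.onSection (A.bracket s (J.onSection t))
    - J.onSection (A.bracket (J.onSection s) t) - A.bracket s t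

/-- The fundamental 2-form `Φ(s, t) = g(s, Jt)`. -/
def fundamentalForm (g : ContMDiffRiemannianMetric I ∞ F E) (s t : Cₛ^∞⟮I; F, E⟯) : M → ℝ :=
  metricFun g s (J.onSection t)

end AlmostComplexStructure

/-- `(E, J, g)` is a Kählerian Lie algebroid: `g` is Hermitian, the fundamental 2-form is
`d_E`-closed and `J` is integrable. -/
structure IsKahlerian (A : LieAlgebroid I F E) (J : AlmostComplexStructure F E I)
    (g : ContMDiffRiemannianMetric I ∞ F E) : Prop where
  hermitian : ∀ s t, metricFun g (J.onSection s) (J.onSection t) = metricFun g s t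
  closed : ∀ s t u x, A.extDeriv₂ (J.fundamentalForm g) s t u x = 0
  integrable : ∀ s t, J.nijenhuis A s t = 0

/-- `P` is a `J`-invariant 2-plane of the fibre `E x`. -/
structure AlmostComplexStructure.IsInvariantPlane (J : AlmostComplexStructure F E I) (x : M)
    (P : Submodule ℝ (E x)) : Prop where
  finrank_eq : finrank ℝ P = 2
  invariant : ∀ v ∈ P, J.toFun x v ∈ P

section Holomorphic

variable [FiniteDimensional ℝ EM] [FiniteDimensional ℝ F] [T2Space M]
  [ContMDiffVectorBundle ∞ F E I]
  (A : LieAlgebroid I F E) (J : AlmostComplexStructure F E I)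
  (g : ContMDiffRiemannianMetric I ∞ F E)

/-- At each point, the holomorphic sectional curvature is independent of the `J`-invariant
2-plane. -/
def HasPointwiseConstantHolomorphicCurvature : Prop :=
  ∀ (x : M) (P Q : Submodule ℝ (E x)), J.IsInvariantPlane x P → J.IsInvariantPlane x Q →
    A.sectionalCurvature g x P = A.sectionalCurvature g x Q

/-- The holomorphic sectional curvature is one constant for all points and all `J`-invariant
2-planes. -/
def HasConstantHolomorphicCurvature : Prop :=
  ∃ c : ℝ, ∀ (x : M) (P : Submodule ℝ (E x)), J.IsInvariantPlane x P →
    A.sectionalCurvature g x P = c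

end Holomorphic

end LieAlgd

end

noncomputable section

set_option linter.unusedSectionVars false

/-! This is the Kähler form of Schur's lemma. The three Kähler conditions together force the
Levi-Civita connection to commute with J (`IsKahlerian.connection_onSection`), so the curvature has,
besides the Riemannian symmetries, invariance under J in each pair of arguments. By polarisation a
tensor with these symmetries is determined by its values on pairs (v, Jv)
(`IsKahlerCurvatureLike.eq_zero_of_holomorphic`). Comparison with `modelCurvature`, an explicit
expression in g and J, therefore gives R = f · model, where f is a quarter of the pointwise
holomorphic curvature (`IsKahlerian.riemann_eq_modelCurvature`).

The model is built from the parallel tensors g and J, hence is parallel, and ∇R = df ⊗ model. The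
second Bianchi identity makes the cyclic sum of this vanish. In rank greater than two, every s
admits a nonzero t orthogonal to s and Js at the given point, and the cyclic sum over s, t, Jt
collapses to a positive multiple of ρ(s)f (`IsKahlerian.deriv_eq_zero_of_riemann_eq`). So f has zero
derivative along the anchor; by transitivity its whole differential vanishes, and by connectedness f
is constant.

The curvature algebra is done on global sections evaluated at a point. Every polarisation has
integer coefficients, so additivity suffices there. -/

/-- A differentiable function with vanishing derivative on a connected manifold without boundary
is constant. -/
theorem exists_eq_const_of_mvfderiv_eq_zero {EM : Type*} [NormedAddCommGroup EM]
    [NormedSpace ℝ EM] {H : Type*} [TopologicalSpace H] {I : ModelWithCorners ℝ EM H}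
    [I.Boundaryless] {M : Type*} [TopologicalSpace M] [ChartedSpace H M] [IsManifold I 1 M]
    [ConnectedSpace M] {f : M → ℝ} (hf : MDifferentiable I 𝓘(ℝ, ℝ) f)
    (h : ∀ x, mvfderiv I f x = 0) : ∃ c, ∀ x, f x = c := by
  have hm : ∀ x, mfderiv I 𝓘(ℝ, ℝ) f x = 0 := fun x => by
    ext v
    have := congrArg (fun L => L v) (h x)
    simpa [mvfderiv] using! this
  have hloc : IsLocallyConstant f := by
    rw [IsLocallyConstant.iff_eventually_eq]
    intro x
    set φ := extChartAt I x
    -- The absence of boundary makes the chart target open, so it contains a ball; convexity of that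
    -- ball turns zero derivative into constancy.
    have hopen : IsOpen φ.target := isOpen_extChartAt_target x
    obtain ⟨r, hr, hball⟩ := Metric.isOpen_iff.1 hopen (φ x) (mem_extChartAt_target x)
    have hd : ∀ z ∈ Metric.ball (φ x) r, HasFDerivAt (f ∘ φ.symm) (0 : EM →L[ℝ] ℝ) z := by
      intro z hz
      have h1 : MDifferentiableAt 𝓘(ℝ, EM) I φ.symm z :=
        ((contMDiffOn_extChartAt_symm (n := 1) x).contMDiffAt
          (hopen.mem_nhds (hball hz))).mdifferentiableAt (by simp)
      have h2 := (hf (φ.symm z)).hasMFDerivAt.comp z h1.hasMFDerivAt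
      rw [hm] at h2
      have h3 := h2.hasFDerivAt
      convert! h3 using 1
    have hconst : ∀ z ∈ Metric.ball (φ x) r, (f ∘ φ.symm) z = (f ∘ φ.symm) (φ x) := by
      intro z hz
      refine (convex_ball (φ x) r).is_const_of_fderivWithin_eq_zero (𝕜 := ℝ)
        (fun y hy => (hd y hy).differentiableAt.differentiableWithinAt) (fun y hy => ?_) hz
        (Metric.mem_ball_self hr)
      rw [fderivWithin_of_isOpen Metric.isOpen_ball hy, (hd y hy).fderiv]
    filter_upwards [extChartAt_source_mem_nhds (I := I) x,
      (continuousAt_extChartAt (I := I) x).preimage_mem_nhds (Metric.ball_mem_nhds _ hr)]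
      with y hy hy'
    have h4 := hconst _ hy'
    simpa only [Function.comp_apply, φ, extChartAt_to_inv, (extChartAt I x).left_inv hy] using h4
  obtain ⟨x₀⟩ := (inferInstance : Nonempty M)
  exact ⟨f x₀, fun x => hloc.apply_eq_of_preconnectedSpace x x₀⟩

/-! ### Algebra of curvature-like tensors of Kähler type -/

/-- An additive curvature-like 4-tensor (with respect to an almost complex structure `J`) of
Kähler type. -/
structure IsKahlerCurvatureLike {V : Type*} [AddCommGroup V] (J : V →+ V)
    (T : V → V → V → V → ℝ) : Prop where
  add_left : ∀ w w' u s t, T (w + w') u s t = T w u s t + T w' u s t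
  skew_left : ∀ w u s t, T u w s t = -T w u s t
  bianchi : ∀ w u s t, T w u s t + T w s t u + T w t u s = 0
  skew_right : ∀ w u s t, T w u t s = -T w u s t
  map_left : ∀ w u s t, T (J w) (J u) s t = T w u s t

namespace IsKahlerCurvatureLike

variable {V : Type*} [AddCommGroup V] {J : V →+ V} {T : V → V → V → V → ℝ}

/-- The octahedron argument: in a signed combination of the four Bianchi identities obtained by
cyclically shifting the arguments, skew-symmetry cancels all terms except the two to be compared. -/
theorem pair_symm (hT : IsKahlerCurvatureLike J T) (w u s t : V) : T s t w u = T w u s t := by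
  have b := hT.bianchi
  have l := hT.skew_left
  have r := hT.skew_right
  linarith [b w u s t, b u s t w, b s t w u, b t w u s, l w u s t, l s t w u, r w u s t,
    r s t w u, l w s t u, l w t u s, l u s t w, l u t w s, r w s t u, r w t u s, r u s t w,
    r u t w s, l s w u t, l t w u s, r s w u t, r t w u s, l u w s t, l t s w u, r u w s t,
    r t s w u, r s w t u, r s u w t, r t u w s, l t u w s, l s u w t, l s w t u, r s u t w,
    r t u s w, r t w s u]

theorem map_right (hT : IsKahlerCurvatureLike J T) (w u s t : V) :
    T w u (J s) (J t) = T w u s t := by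
  rw [← hT.pair_symm, hT.map_left, hT.pair_symm]

theorem add₂ (hT : IsKahlerCurvatureLike J T) (w u u' s t : V) :
    T w (u + u') s t = T w u s t + T w u' s t := by
  rw [hT.skew_left, hT.add_left, hT.skew_left w u, hT.skew_left w u']; ring

theorem add₃ (hT : IsKahlerCurvatureLike J T) (w u s s' t : V) :
    T w u (s + s') t = T w u s t + T w u s' t := by
  rw [← hT.pair_symm, hT.add_left, hT.pair_symm w u s, hT.pair_symm w u s']

theorem add₄ (hT : IsKahlerCurvatureLike J T) (w u s t t' : V) :
    T w u s (t + t') = T w u s t + T w u s t' := by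
  rw [← hT.pair_symm, hT.add₂, hT.pair_symm w u s t, hT.pair_symm w u s t']

theorem neg₁ (hT : IsKahlerCurvatureLike J T) (w u s t : V) : T (-w) u s t = -T w u s t :=
  map_neg (AddMonoidHom.mk' (fun w => T w u s t) fun w w' => hT.add_left w w' u s t) w

theorem neg₂ (hT : IsKahlerCurvatureLike J T) (w u s t : V) : T w (-u) s t = -T w u s t := by
  rw [hT.skew_left, hT.neg₁, hT.skew_left w u, neg_neg]

theorem neg₃ (hT : IsKahlerCurvatureLike J T) (w u s t : V) : T w u (-s) t = -T w u s t := by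
  rw [← hT.pair_symm, hT.neg₁, hT.pair_symm]

theorem neg₄ (hT : IsKahlerCurvatureLike J T) (w u s t : V) : T w u s (-t) = -T w u s t := by
  rw [← hT.pair_symm, hT.neg₂, hT.pair_symm]

/-- A curvature-like tensor is determined by its sectional curvatures. -/
theorem eq_zero_of_sectional (hT : IsKahlerCurvatureLike J T) (h : ∀ x y, T x y x y = 0)
    (w u s t : V) : T w u s t = 0 := by
  -- Polarisation in the second and fourth slots, where pair symmetry merges the two cross terms;
  -- `h2` then polarises in the first and third.
  have h1 : ∀ x y z, T x y x z = 0 := fun x y z => by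
    have := h x (y + z)
    rw [hT.add₂, hT.add₄, hT.add₄, h, h, hT.pair_symm x y x z] at this
    linarith
  have h2 : ∀ x y z v, T x y z v = -T z y x v := fun x y z v => by
    have := h1 (x + z) y v
    rw [hT.add_left, hT.add₃, hT.add₃, h1, h1] at this
    linarith
  have b := hT.bianchi w u s t
  -- Skewness in the first and third slots, added to the curvature symmetries, makes the three
  -- Bianchi terms equal, so that 3T = 0.
  have e1 : T w s t u = T w u s t := by
    rw [h2, hT.skew_left, hT.pair_symm, neg_neg, hT.skew_left, hT.skew_right, h2 u, hT.skew_left,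
      hT.skew_right, ← hT.pair_symm, hT.pair_symm]
  have e2 : T w t u s = T w u s t := by
    linarith [h2 w t u s, hT.pair_symm w u t s, hT.skew_right w u s t, hT.skew_left u t w s,
      hT.pair_symm u t w s, h2 w s t u, hT.skew_left w s t u, h2 t u w s]
  linarith

/-- A curvature-like tensor of Kähler type is determined by its holomorphic sectional
curvatures. -/
theorem eq_zero_of_holomorphic (hT : IsKahlerCurvatureLike J T) (hJ : ∀ v, J (J v) = -v)
    (h : ∀ v, T v (J v) v (J v) = 0) (w u s t : V) : T w u s t = 0 := by
  -- In the sum of the expansions at x + y and x - y only the terms quadratic in both x and y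
  -- survive. The Bianchi identity for x, Jx, y, Jy expresses T(x,Jx,y,Jy) through the two values
  -- T(x,y,x,y) and T(x,Jy,x,Jy).
  have key : ∀ x y, T x y x y + 3 * T x (J y) x (J y) = 0 := fun x y => by
    have hp := h (x + y)
    have hm := h (x + -y)
    simp only [map_add, map_neg, hT.add_left, hT.add₂, hT.add₃, hT.add₄, hT.neg₁, hT.neg₂,
      hT.neg₃, hT.neg₄, h] at hp hm
    -- Since J² = -1, moving J across a pair and then exchanging the two arguments produces two
    -- cancelling signs.
    have s1 : ∀ a b c d, T a (J b) c d = T b (J a) c d := fun a b c d => by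
      rw [← hT.map_left a, hJ, hT.neg₂, hT.skew_left, neg_neg]
    have s2 : ∀ a b c d, T a b c (J d) = T a b d (J c) := fun a b c d => by
      rw [← hT.map_right a b c, hJ, hT.neg₄, hT.skew_right, neg_neg]
    have b1 := hT.bianchi x (J x) y (J y)
    have b2 : T x y (J y) (J x) = -T x y x y := by
      rw [hT.map_right, hT.skew_right]
    have b3 : T x (J y) (J x) y = -T x (J y) x (J y) := by
      rw [← hT.map_right, hJ, hT.neg₃]
    rw [b2, b3] at b1
    have c1 := hT.pair_symm x (J x) y (J y)
    have c2 := s1 x y x (J y)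
    have c3 := s1 x y y (J x)
    have c4 := s2 x (J y) x y
    linarith
  refine hT.eq_zero_of_sectional (fun x y => ?_) w u s t
  -- Replacing y by Jy exchanges the two unknowns, giving the system p + 3q = 0 and q + 3p = 0,
  -- whose only solution is zero.
  have h1 := key x y
  have h2 := key x (J y)
  rw [hJ, hT.neg₂, hT.neg₄, neg_neg] at h2
  linarith

theorem sub_const_mul {T' : V → V → V → V → ℝ} (hT : IsKahlerCurvatureLike J T)
    (hT' : IsKahlerCurvatureLike J T') (c : ℝ) :
    IsKahlerCurvatureLike J fun w u s t => T w u s t - c * T' w u s t where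
  add_left w w' u s t := by rw [hT.add_left, hT'.add_left]; ring
  skew_left w u s t := by rw [hT.skew_left, hT'.skew_left]; ring
  skew_right w u s t := by rw [hT.skew_right, hT'.skew_right]; ring
  bianchi w u s t := by linear_combination hT.bianchi w u s t - c * hT'.bianchi w u s t
  map_left w u s t := by rw [hT.map_left, hT'.map_left]

end IsKahlerCurvatureLike

namespace LieAlgd

variable {EM : Type*} [NormedAddCommGroup EM] [NormedSpace ℝ EM]
  {H : Type*} [TopologicalSpace H] {I : ModelWithCorners ℝ EM H}
  {M : Type*} [TopologicalSpace M] [ChartedSpace H M] [IsManifold I ∞ M]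
  {F : Type*} [NormedAddCommGroup F] [NormedSpace ℝ F]
  {E : M → Type*} [TopologicalSpace (TotalSpace F E)]
  [∀ x, AddCommGroup (E x)] [∀ x, Module ℝ (E x)] [∀ x, TopologicalSpace (E x)]
  [FiberBundle F E] [VectorBundle ℝ F E]

/-! ### The almost complex structure on sections and its skew-adjointness -/

section AlmostComplex

variable (g : ContMDiffRiemannianMetric I ∞ F E)

theorem metricFun_neg_left (s t : Cₛ^∞⟮I; F, E⟯) : metricFun g (-s) t = -metricFun g s t := by
  funext x; simp [metricFun]

theorem metricFun_neg_right (s t : Cₛ^∞⟮I; F, E⟯) : metricFun g s (-t) = -metricFun g s t := by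
  funext x; simp [metricFun]

variable (J : AlmostComplexStructure F E I)

/-- The action of an almost complex structure on sections as an additive homomorphism. -/
def AlmostComplexStructure.onSectionHom : Cₛ^∞⟮I; F, E⟯ →+ Cₛ^∞⟮I; F, E⟯ :=
  AddMonoidHom.mk' J.onSection fun s t =>
    ContMDiffSection.ext fun x => map_add (J.toFun x) (s x) (t x)

theorem AlmostComplexStructure.onSection_onSection (s : Cₛ^∞⟮I; F, E⟯) :
    J.onSection (J.onSection s) = -s :=
  ContMDiffSection.ext fun x => J.sq x (s x)

theorem AlmostComplexStructure.onSection_neg (s : Cₛ^∞⟮I; F, E⟯) :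
    J.onSection (-s) = -J.onSection s :=
  map_neg J.onSectionHom s

theorem AlmostComplexStructure.onSection_sub (s t : Cₛ^∞⟮I; F, E⟯) :
    J.onSection (s - t) = J.onSection s - J.onSection t :=
  map_sub J.onSectionHom s t

variable {g J}

theorem IsKahlerian.metricFun_onSection_left {A : LieAlgebroid I F E} (hK : IsKahlerian A J g)
    (s t : Cₛ^∞⟮I; F, E⟯) : metricFun g (J.onSection s) t = -metricFun g s (J.onSection t) := by
  rw [← hK.hermitian s (J.onSection t), J.onSection_onSection, metricFun_neg_right, neg_neg]

theorem IsKahlerian.metricFun_onSection_self {A : LieAlgebroid I F E} (hK : IsKahlerian A J g)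
    (s : Cₛ^∞⟮I; F, E⟯) : metricFun g s (J.onSection s) = 0 := by
  have h := hK.metricFun_onSection_left s s
  rw [metricFun_comm] at h
  exact self_eq_neg.1 h

end AlmostComplex

/-! ### Bianchi identities for the Levi-Civita connection -/

namespace LieAlgebroid

variable (A : LieAlgebroid I F E) {g : ContMDiffRiemannianMetric I ∞ F E}

theorem deriv_neg (s : Cₛ^∞⟮I; F, E⟯) {f : M → ℝ} (hf : ContMDiff I 𝓘(ℝ, ℝ) ∞ f) :
    A.deriv s (-f) = -A.deriv s f := by
  have h := A.deriv_add s (h := -f) hf hf.neg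
  rw [add_neg_cancel, eq_comm] at h
  rw [eq_neg_iff_add_eq_zero, add_comm, h]
  exact A.deriv_const s 0

theorem deriv_sub (s : Cₛ^∞⟮I; F, E⟯) {f h : M → ℝ} (hf : ContMDiff I 𝓘(ℝ, ℝ) ∞ f)
    (hh : ContMDiff I 𝓘(ℝ, ℝ) ∞ h) : A.deriv s (f - h) = A.deriv s f - A.deriv s h := by
  rw [sub_eq_add_neg, A.deriv_add s (h := -h) hf hh.neg, A.deriv_neg s hh, ← sub_eq_add_neg]

variable {A}

theorem LinearConnection.IsLeviCivita.deriv_metricFun {D : A.LinearConnection}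
    (hD : D.IsLeviCivita g) (s t u : Cₛ^∞⟮I; F, E⟯) : A.deriv s (metricFun g t u) =
      metricFun g (D.toFun s t) u + metricFun g t (D.toFun s u) :=
  funext fun x => hD.metric s t u x

theorem LinearConnection.IsLeviCivita.bracket_eq {D : A.LinearConnection}
    (hD : D.IsLeviCivita g) (s t : Cₛ^∞⟮I; F, E⟯) :
    A.bracket s t = D.toFun s t - D.toFun t s :=
  (sub_eq_zero.1 (hD.torsion_free s t)).symm

/-- The first Bianchi identity. -/
theorem LinearConnection.IsLeviCivita.curvature_cyclic {D : A.LinearConnection}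
    (hD : D.IsLeviCivita g) (s t u : Cₛ^∞⟮I; F, E⟯) :
    D.curvature s t u + D.curvature t u s + D.curvature u s t = 0 := by
  -- Only the outer bracket and the first inner term are expanded by torsion-freeness; the remaining
  -- D along a bracket is exactly the last term of the curvature, so the Jacobi identity becomes the
  -- claim.
  have h : ∀ a b c, A.bracket a (A.bracket b c) =
      D.toFun a (D.toFun b c) - D.toFun a (D.toFun c b) - D.toFun (A.bracket b c) a :=
    fun a b c => by rw [hD.bracket_eq a, ← map_sub, ← hD.bracket_eq b c]
  rw [← A.jacobi s t u, h, h, h]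
  simp only [curvature]
  abel

theorem LinearConnection.curvature_swap (D : A.LinearConnection) (s t u : Cₛ^∞⟮I; F, E⟯) :
    D.curvature t s u = -D.curvature s t u := by
  simp only [curvature, A.bracket_skew t s, map_neg, LinearMap.neg_apply]
  abel

theorem LinearConnection.curvature_sub_left (D : A.LinearConnection)
    (s s' t u : Cₛ^∞⟮I; F, E⟯) :
    D.curvature (s - s') t u = D.curvature s t u - D.curvature s' t u := by
  simp only [curvature, map_sub, LinearMap.sub_apply]
  abel

/-- The covariant derivative of the curvature, `((∇_s R)(t, u)) v`. -/
def LinearConnection.covDerivCurvature (D : A.LinearConnection) (s t u v : Cₛ^∞⟮I; F, E⟯) :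
    Cₛ^∞⟮I; F, E⟯ :=
  D.toFun s (D.curvature t u v) - D.curvature t u (D.toFun s v)
    - D.curvature (D.toFun s t) u v - D.curvature t (D.toFun s u) v

/-- The second Bianchi identity. -/
theorem LinearConnection.IsLeviCivita.covDerivCurvature_cyclic {D : A.LinearConnection}
    (hD : D.IsLeviCivita g) (s t u v : Cₛ^∞⟮I; F, E⟯) :
    D.covDerivCurvature s t u v + D.covDerivCurvature t u s v + D.covDerivCurvature u s t v
      = 0 := by
  -- Torsion-freeness pairs the correction terms of the cyclic sum into curvatures along brackets.
  have h : ∀ a b c, D.curvature (A.bracket a b) c v =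
      D.curvature (D.toFun a b) c v + D.curvature c (D.toFun b a) v := fun a b c => by
    rw [hD.bracket_eq, D.curvature_sub_left, D.curvature_swap (D.toFun b a) c]
    abel
  have h₁ : D.covDerivCurvature s t u v + D.covDerivCurvature t u s v
      + D.covDerivCurvature u s t v =
      (D.toFun s (D.curvature t u v) - D.curvature t u (D.toFun s v))
      + (D.toFun t (D.curvature u s v) - D.curvature u s (D.toFun t v))
      + (D.toFun u (D.curvature s t v) - D.curvature s t (D.toFun u v))
      - (D.curvature (A.bracket s t) u v + D.curvature (A.bracket t u) s v
        + D.curvature (A.bracket u s) t v) := by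
    rw [h, h, h]
    simp only [covDerivCurvature]
    abel
  -- What remains after the commutators of the operators D cancel is D along the Jacobi sum, which
  -- is zero.
  have h₂ : D.toFun (A.bracket (A.bracket s t) u) v + D.toFun (A.bracket (A.bracket t u) s) v
      + D.toFun (A.bracket (A.bracket u s) t) v = 0 := by
    rw [← LinearMap.add_apply, ← LinearMap.add_apply, ← map_add, ← map_add,
      A.bracket_skew (A.bracket s t) u, A.bracket_skew (A.bracket t u) s,
      A.bracket_skew (A.bracket u s) t]
    have : -A.bracket u (A.bracket s t) + -A.bracket s (A.bracket t u)
        + -A.bracket t (A.bracket u s) = 0 := by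
      rw [← neg_zero, ← A.jacobi s t u]; abel
    rw [this, map_zero, LinearMap.zero_apply]
  rw [h₁, ← h₂]
  simp only [curvature, map_sub]
  abel

end LieAlgebroid

/-! ### Parallelism of J and the resulting curvature symmetries -/

section Kahler

variable {A : LieAlgebroid I F E} {J : AlmostComplexStructure F E I}
  {g : ContMDiffRiemannianMetric I ∞ F E}
  [FiniteDimensional ℝ EM] [FiniteDimensional ℝ F] [T2Space M] [ContMDiffVectorBundle ∞ F E I]

/-- On a Kählerian Lie algebroid the complex structure is parallel. -/
theorem IsKahlerian.connection_onSection (hK : IsKahlerian A J g) {D : A.LinearConnection}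
    (hD : D.IsLeviCivita g) (s t : Cₛ^∞⟮I; F, E⟯) :
    D.toFun s (J.onSection t) = J.onSection (D.toFun s t) := by
  -- `b s t u` is g((D_s J)t, u), the J of the second term having been moved onto u by
  -- skew-adjointness. It is kept opaque so that its values are atoms for the linear algebra that
  -- follows.
  obtain ⟨b, hb⟩ : ∃ b : Cₛ^∞⟮I; F, E⟯ → Cₛ^∞⟮I; F, E⟯ → Cₛ^∞⟮I; F, E⟯ → M → ℝ,
      ∀ s t u, b s t u = metricFun g (D.toFun s (J.onSection t)) u +
        metricFun g (D.toFun s t) (J.onSection u) := ⟨_, fun _ _ _ => rfl⟩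
  have skew : ∀ s t u, b s u t = -b s t u := fun s t u => by
    have h := congrArg (A.deriv s) (hK.metricFun_onSection_left t u)
    rw [A.deriv_neg _ (contMDiff_metricFun g _ _), hD.deriv_metricFun, hD.deriv_metricFun] at h
    rw [hb, hb, metricFun_comm g _ t, metricFun_comm g _ (J.onSection t)]
    linear_combination h
  have closed : ∀ s t u, b s t u + b t u s + b u s t = 0 := fun s t u => by
    -- With D metric and torsion-free, dΦ is up to sign the cyclic sum of `b`.
    have h : A.extDeriv₂ (J.fundamentalForm g) s t u = 0 := funext (hK.closed s t u)
    have h' : A.extDeriv₂ (J.fundamentalForm g) s t u =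
        A.deriv s (metricFun g t (J.onSection u)) - A.deriv t (metricFun g s (J.onSection u))
        + A.deriv u (metricFun g s (J.onSection t)) - metricFun g (A.bracket s t) (J.onSection u)
        + metricFun g (A.bracket s u) (J.onSection t)
        - metricFun g (A.bracket t u) (J.onSection s) := rfl
    rw [h'] at h
    simp only [hD.deriv_metricFun, hD.bracket_eq, metricFun_sub_left] at h
    have h1 := skew s t u
    have h2 := skew u s t
    have e1 := hb s u t
    have e2 := hb t u s
    have e3 := hb u t s
    rw [metricFun_comm g _ t] at e1
    rw [metricFun_comm g _ s] at e2 e3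
    linear_combination -h - e1 + e2 - e3 + h1 + h2
  have nij : ∀ s t u, b (J.onSection s) t u - b (J.onSection t) s u + b s t (J.onSection u)
      - b t s (J.onSection u) = 0 := fun s t u => by
    -- Writing brackets through D turns the Nijenhuis tensor into an expression in DJ alone.
    have h := congrArg (fun r => metricFun g r u) (hK.integrable s t)
    have h0 : metricFun g 0 u = 0 := by funext x; simp [metricFun]
    simp only [AlmostComplexStructure.nijenhuis, metricFun_sub_left, h0,
      hK.metricFun_onSection_left, hD.bracket_eq] at h
    simp only [hb, J.onSection_onSection, metricFun_neg_right]
    linear_combination h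
  -- Closedness at (s, t, Ju) trades the two terms of `nij` containing Ju in the last slot for one
  -- with Ju in the first. Adding this relation to its cyclic shift leaves 2 b(Js, t, u).
  have cyc : ∀ s t u, b (J.onSection s) t u + b (J.onSection t) u s - b (J.onSection u) s t = 0 :=
    fun s t u => by
      linear_combination nij s t u - closed s t (J.onSection u) + skew t s (J.onSection u)
        + skew (J.onSection t) s u
  have zero : ∀ s t u, b (J.onSection s) t u = 0 := fun s t u => by
    have h : (2 : M → ℝ) * b (J.onSection s) t u = 0 := by
      linear_combination cyc s t u + cyc u s t
    funext x
    have h' := congrFun h x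
    simpa using h'
  refine section_ext_metric g fun u x => ?_
  -- Replacing s by Js removes the J from the first slot, up to sign.
  have h := congrFun (zero (J.onSection s) t u) x
  rw [J.onSection_onSection, hb] at h
  rw [hK.metricFun_onSection_left]
  simp only [map_neg, LinearMap.neg_apply, metricFun_neg_left, Pi.add_apply, Pi.neg_apply,
    Pi.zero_apply] at h ⊢
  linarith

theorem IsKahlerian.curvature_onSection (hK : IsKahlerian A J g) {D : A.LinearConnection}
    (hD : D.IsLeviCivita g) (s t u : Cₛ^∞⟮I; F, E⟯) :
    D.curvature s t (J.onSection u) = J.onSection (D.curvature s t u) := by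
  simp only [LieAlgebroid.LinearConnection.curvature, hK.connection_onSection hD,
    J.onSection_sub]

/-- Since J is parallel it commutes with R(s,t), and the Hermitian metric then gives the invariance
under J; the other symmetries are Riemannian. The underlying additive group is that of global
sections, with x fixed. -/
theorem IsKahlerian.isKahlerCurvatureLike_riemann (hK : IsKahlerian A J g) (x : M) :
    IsKahlerCurvatureLike J.onSectionHom fun w u s t => A.riemann g w u s t x where
  add_left w w' u s t := A.riemann_add₁ g s t u w w' x
  skew_left w u s t := A.riemann_swap₁₂ g s t u w x
  skew_right w u s t := A.riemann_swap₃₄ g s t u w x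
  bianchi w u s t := by
    have h := congrArg (fun r => metricFun g r w x)
      ((A.leviCivita_spec g).curvature_cyclic s t u)
    have h0 : metricFun g 0 w x = 0 := by simp [metricFun]
    simp only [metricFun_add_left, Pi.add_apply, h0] at h
    simp only [LieAlgebroid.riemann]
    linarith
  map_left w u s t := by
    change metricFun g ((A.leviCivita g).curvature s t (J.onSection u)) (J.onSection w) x = _
    rw [hK.curvature_onSection (A.leviCivita_spec g), hK.hermitian]
    rfl

/-! ### The model curvature tensor and covariant derivatives of 4-tensors -/

variable (J g) in
/-- Four times the curvature tensor of a space of constant holomorphic sectional curvature `1`. -/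
def modelCurvature (w u s t : Cₛ^∞⟮I; F, E⟯) : M → ℝ :=
  metricFun g w s * metricFun g u t - metricFun g w t * metricFun g u s
    + metricFun g w (J.onSection s) * metricFun g u (J.onSection t)
    - metricFun g w (J.onSection t) * metricFun g u (J.onSection s)
    -- The coefficient 2 is written as a repeated summand, so that the tensor is a signed sum of
    -- products of metric functions and each summand is differentiated in the same way.
    + (metricFun g w (J.onSection u) * metricFun g s (J.onSection t)
      + metricFun g w (J.onSection u) * metricFun g s (J.onSection t))

theorem IsKahlerian.isKahlerCurvatureLike_modelCurvature (hK : IsKahlerian A J g) (x : M) :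
    IsKahlerCurvatureLike J.onSectionHom fun w u s t => modelCurvature J g w u s t x := by
  have sk : ∀ s t, metricFun g t (J.onSection s) x = -metricFun g s (J.onSection t) x :=
    fun s t => by rw [metricFun_comm, hK.metricFun_onSection_left]; rfl
  have sy : ∀ s t, metricFun g t s x = metricFun g s t x := fun s t => by rw [metricFun_comm]
  refine ⟨fun w w' u s t => ?_, fun w u s t => ?_, fun w u s t => ?_, fun w u s t => ?_,
    fun w u s t => ?_⟩
  · simp only [modelCurvature, metricFun_add_left, Pi.add_apply, Pi.sub_apply, Pi.mul_apply]
    ring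
  · simp only [modelCurvature, Pi.add_apply, Pi.sub_apply, Pi.mul_apply, sk w u]
    ring
  · simp only [modelCurvature, Pi.add_apply, Pi.sub_apply, Pi.mul_apply, sk u s, sk u t, sk s t,
      sy u s, sy u t, sy s t]
    ring
  · simp only [modelCurvature, Pi.add_apply, Pi.sub_apply, Pi.mul_apply, sk s t]
    ring
  · change modelCurvature J g (J.onSection w) (J.onSection u) s t x = _
    simp only [modelCurvature, Pi.add_apply, Pi.sub_apply, Pi.mul_apply,
      hK.metricFun_onSection_left, J.onSection_onSection, J.onSection_neg, metricFun_neg_right,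
      Pi.neg_apply]
    ring

/-- This fixes the normalisation: the terms contribute 1 + 1 + 2, which is why the curvature
function is divided by 4 later. -/
theorem IsKahlerian.modelCurvature_holomorphic (hK : IsKahlerian A J g)
    (s : Cₛ^∞⟮I; F, E⟯) :
    modelCurvature J g s (J.onSection s) s (J.onSection s) = 4 * metricFun g s s ^ 2 := by
  simp only [modelCurvature, J.onSection_onSection, hK.hermitian, hK.metricFun_onSection_self,
    metricFun_neg_right]
  ring

/-- The covariant derivative `(∇_s T)(w, v, t, u)` of a 4-tensor. -/
def LieAlgebroid.LinearConnection.covDeriv₄ (D : A.LinearConnection)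
    (T : Cₛ^∞⟮I; F, E⟯ → Cₛ^∞⟮I; F, E⟯ → Cₛ^∞⟮I; F, E⟯ → Cₛ^∞⟮I; F, E⟯ → M → ℝ)
    (s w v t u : Cₛ^∞⟮I; F, E⟯) : M → ℝ :=
  A.deriv s (T w v t u) - T (D.toFun s w) v t u - T w (D.toFun s v) t u
    - T w v (D.toFun s t) u - T w v t (D.toFun s u)

/-- Metric compatibility cancels the correction in the slot `w`, so that the second Bianchi identity
for operators can be used on the 4-tensor. -/
theorem LieAlgebroid.covDeriv₄_riemann (s w v t u : Cₛ^∞⟮I; F, E⟯) :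
    (A.leviCivita g).covDeriv₄ (A.riemann g) s w v t u =
      metricFun g ((A.leviCivita g).covDerivCurvature s t u v) w := by
  have h : ∀ w u s t, A.riemann g w u s t =
    metricFun g ((A.leviCivita g).curvature s t u) w := fun _ _ _ _ => rfl
  simp only [LinearConnection.covDeriv₄, h, (A.leviCivita_spec g).deriv_metricFun,
    LinearConnection.covDerivCurvature, metricFun_sub_left]
  ring

theorem contMDiff_modelCurvature (w v t u : Cₛ^∞⟮I; F, E⟯) :
    ContMDiff I 𝓘(ℝ, ℝ) ∞ (modelCurvature J g w v t u) := by
  have h : ∀ a b c d, ContMDiff I 𝓘(ℝ, ℝ) ∞ (metricFun g a b * metricFun g c d) :=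
    fun a b c d => (contMDiff_metricFun g a b).mul (contMDiff_metricFun g c d)
  exact ((((h _ _ _ _).sub (h _ _ _ _)).add (h _ _ _ _)).sub (h _ _ _ _)).add
    ((h _ _ _ _).add (h _ _ _ _))

/-- The model curvature tensor is parallel. -/
theorem IsKahlerian.covDeriv₄_modelCurvature (hK : IsKahlerian A J g) {D : A.LinearConnection}
    (hD : D.IsLeviCivita g) (s w v t u : Cₛ^∞⟮I; F, E⟯) :
    D.covDeriv₄ (modelCurvature J g) s w v t u = 0 := by
  have h : ∀ a b c d, ContMDiff I 𝓘(ℝ, ℝ) ∞ (metricFun g a b * metricFun g c d) :=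
    fun a b c d => (contMDiff_metricFun g a b).mul (contMDiff_metricFun g c d)
  have hd : ∀ a b c d, A.deriv s (metricFun g a b * metricFun g c d) =
      (metricFun g (D.toFun s a) b + metricFun g a (D.toFun s b)) * metricFun g c d
      + metricFun g a b * (metricFun g (D.toFun s c) d + metricFun g c (D.toFun s d)) :=
    fun a b c d => by
      rw [A.deriv_mul s (contMDiff_metricFun g a b) (contMDiff_metricFun g c d),
        hD.deriv_metricFun, hD.deriv_metricFun]
  rw [LieAlgebroid.LinearConnection.covDeriv₄]
  simp only [modelCurvature]
  have ha : ∀ {p q : M → ℝ}, ContMDiff I 𝓘(ℝ, ℝ) ∞ p → ContMDiff I 𝓘(ℝ, ℝ) ∞ q →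
    ContMDiff I 𝓘(ℝ, ℝ) ∞ (p + q) := fun hp hq => hp.add hq
  have hs : ∀ {p q : M → ℝ}, ContMDiff I 𝓘(ℝ, ℝ) ∞ p → ContMDiff I 𝓘(ℝ, ℝ) ∞ q →
    ContMDiff I 𝓘(ℝ, ℝ) ∞ (p - q) := fun hp hq => hp.sub hq
  rw [A.deriv_add s (hs (ha (hs (h _ _ _ _) (h _ _ _ _)) (h _ _ _ _)) (h _ _ _ _))
      (ha (h _ _ _ _) (h _ _ _ _)),
    A.deriv_sub s (ha (hs (h _ _ _ _) (h _ _ _ _)) (h _ _ _ _)) (h _ _ _ _),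
    A.deriv_add s (hs (h _ _ _ _) (h _ _ _ _)) (h _ _ _ _),
    A.deriv_sub s (h _ _ _ _) (h _ _ _ _), A.deriv_add s (h _ _ _ _) (h _ _ _ _)]
  -- Once D is moved past J, each product-rule term matches one correction term.
  simp only [hd, hK.connection_onSection hD]
  ring

end Kahler

/-! ### From pointwise to global constancy -/

section Schur

variable {A : LieAlgebroid I F E} {J : AlmostComplexStructure F E I}
  {g : ContMDiffRiemannianMetric I ∞ F E}

/-- Applying J to a relation between v and Jv yields a second one; eliminating Jv leaves (a² + b²)v
= 0. -/
theorem AlmostComplexStructure.linearIndependent_pair {x : M} {v : E x} (hv : v ≠ 0) :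
    LinearIndependent ℝ ![v, J.toFun x v] := by
  rw [LinearIndependent.pair_iff]
  intro a b h
  have h' : a • J.toFun x v - b • v = 0 := by
    have := congrArg (J.toFun x) h
    rw [map_add, map_smul, map_smul, J.sq, map_zero] at this
    rw [← this]; module
  have h2 : (a ^ 2 + b ^ 2) • v = 0 := by
    have : (a ^ 2 + b ^ 2) • v = a • (a • v + b • J.toFun x v) - b • (a • J.toFun x v - b • v) := by
      module
    rw [this, h, h', smul_zero, smul_zero, sub_zero]
  have h3 := (smul_eq_zero.1 h2).resolve_right hv
  constructor <;> nlinarith [sq_nonneg a, sq_nonneg b]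

theorem AlmostComplexStructure.isInvariantPlane_span {x : M} {v : E x} (hv : v ≠ 0) :
    J.IsInvariantPlane x (Submodule.span ℝ {v, J.toFun x v}) where
  finrank_eq := by
    have h := finrank_span_eq_card (J.linearIndependent_pair hv)
    rwa [Matrix.range_cons, Matrix.range_cons, Matrix.range_empty, Set.union_empty,
      Set.singleton_union, Fintype.card_fin] at h
  invariant w hw := by
    obtain ⟨a, b, rfl⟩ := Submodule.mem_span_pair.1 hw
    refine Submodule.mem_span_pair.2 ⟨-b, a, ?_⟩
    rw [map_add, map_smul, map_smul, J.sq]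
    module

theorem metricFun_self_pos (s : Cₛ^∞⟮I; F, E⟯) {x : M} (hs : s x ≠ 0) :
    0 < metricFun g s s x := g.pos x _ hs

variable [FiniteDimensional ℝ EM] [FiniteDimensional ℝ F] [T2Space M]
  [ContMDiffVectorBundle ∞ F E I]

/-- As Jv is orthogonal to v and of equal length, the Gram determinant of the pair is g(v,v)². -/
theorem IsKahlerian.riemann_holomorphic (hK : IsKahlerian A J g) (s : Cₛ^∞⟮I; F, E⟯) {x : M}
    (hs : s x ≠ 0) : A.riemann g s (J.onSection s) s (J.onSection s) x =
      A.sectionalCurvature g x (Submodule.span ℝ {s x, J.toFun x (s x)}) *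
        metricFun g s s x ^ 2 := by
  have h := A.sectionalCurvature_eq g (s := s) (t := J.onSection s) x
    (J.linearIndependent_pair hs)
  change A.sectionalCurvature g x (Submodule.span ℝ {s x, J.toFun x (s x)}) = _ at h
  have h0 := (metricFun_self_pos (g := g) s hs).ne'
  rw [h, LieAlgebroid.frameCurvature, hK.hermitian, hK.metricFun_onSection_self]
  simp only [Pi.zero_apply]
  field_simp
  ring

/-- If the holomorphic sectional curvature is pointwise constant, the curvature tensor is
pointwise that of a complex space form. -/
theorem IsKahlerian.riemann_eq_modelCurvature (hK : IsKahlerian A J g) {k : M → ℝ}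
    (hk : ∀ x P, J.IsInvariantPlane x P → A.sectionalCurvature g x P = k x)
    (w u s t : Cₛ^∞⟮I; F, E⟯) :
    A.riemann g w u s t = (fun x => k x / 4) * modelCurvature J g w u s t := by
  funext x
  have hT := (hK.isKahlerCurvatureLike_riemann x).sub_const_mul
    (hK.isKahlerCurvatureLike_modelCurvature x) (k x / 4)
  refine sub_eq_zero.1 (hT.eq_zero_of_holomorphic (fun v => J.onSection_onSection v)
    (fun v => ?_) w u s t)
  change A.riemann g v (J.onSection v) v (J.onSection v) x
    - k x / 4 * modelCurvature J g v (J.onSection v) v (J.onSection v) x = 0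
  rw [hK.modelCurvature_holomorphic]
  -- A section vanishing at x spans no plane there, but both tensors are then zero.
  by_cases hv : v x = 0
  · simp [LieAlgebroid.riemann, metricFun, hv]
  · rw [hK.riemann_holomorphic v hv, hk x _ (J.isInvariantPlane_span hv)]
    simp only [Pi.mul_apply, Pi.pow_apply, Pi.ofNat_apply]
    ring

theorem LieAlgebroid.contMDiff_riemann (w u s t : Cₛ^∞⟮I; F, E⟯) :
    ContMDiff I 𝓘(ℝ, ℝ) ∞ (A.riemann g w u s t) :=
  contMDiff_metricFun g _ w

/-- A priori `k` is only a choice of values. Around a point where a section s is nonzero it equals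
the quotient of the smooth functions 𝓡(s,Js,s,Js) and g(s,s)². -/
theorem IsKahlerian.contMDiff_curvatureFunction (hK : IsKahlerian A J g) {k : M → ℝ}
    (hk : ∀ x P, J.IsInvariantPlane x P → A.sectionalCurvature g x P = k x)
    (hE : ∀ x, Nontrivial (E x)) : ContMDiff I 𝓘(ℝ, ℝ) ∞ k := by
  intro x
  obtain ⟨v, hv⟩ := exists_ne (0 : E x)
  obtain ⟨s, rfl⟩ := exists_section (I := I) (F := F) x v
  have hg := contMDiff_metricFun g s s
  have hg0 := (metricFun_self_pos (g := g) s hv).ne'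
  have h : ContMDiffAt I 𝓘(ℝ, ℝ) ∞ (fun y => A.riemann g s (J.onSection s) s (J.onSection s) y *
      (metricFun g s s y ^ 2)⁻¹) x :=
    (LieAlgebroid.contMDiff_riemann s (J.onSection s) s (J.onSection s) x).mul
      (((hg x).pow 2).inv₀ (pow_ne_zero 2 hg0))
  refine h.congr_of_eventuallyEq ?_
  filter_upwards [hg.continuous.continuousAt.eventually_ne hg0] with y hy
  have hsy : s y ≠ 0 := fun h0 => hy (by simp [metricFun, h0])
  rw [hK.riemann_holomorphic s hsy, hk y _ (J.isInvariantPlane_span hsy),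
    mul_inv_cancel_right₀ (pow_ne_zero 2 hy)]

/-- If the curvature tensor is a multiple of the model curvature by a smooth function, then in
rank at least four the function is constant along the anchor. -/
theorem IsKahlerian.deriv_eq_zero_of_riemann_eq (hK : IsKahlerian A J g) {f : M → ℝ}
    (hf : ContMDiff I 𝓘(ℝ, ℝ) ∞ f)
    (h : ∀ w u s t, A.riemann g w u s t = f * modelCurvature J g w u s t) {x : M}
    (hE : 2 < finrank ℝ (E x)) (s : Cₛ^∞⟮I; F, E⟯) : A.deriv s f x = 0 := by
  have hD := A.leviCivita_spec g
  -- In the covariant derivative of f · model only the derivative of f survives, the model being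
  -- parallel.
  have hcov : ∀ s w v t u, A.deriv s f * modelCurvature J g w v t u =
      metricFun g ((A.leviCivita g).covDerivCurvature s t u v) w := fun s w v t u => by
    have h1 := hK.covDeriv₄_modelCurvature hD s w v t u
    rw [← A.covDeriv₄_riemann]
    simp only [LieAlgebroid.LinearConnection.covDeriv₄, h,
      A.deriv_mul s hf (contMDiff_modelCurvature _ _ _ _)] at h1 ⊢
    linear_combination -f * h1
  have hcyc : ∀ s t u v w, A.deriv s f * modelCurvature J g w v t u
      + A.deriv t f * modelCurvature J g w v u s
      + A.deriv u f * modelCurvature J g w v s t = 0 := fun s t u v w => by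
    rw [hcov, hcov, hcov, ← metricFun_add_left, ← metricFun_add_left,
      hD.covDerivCurvature_cyclic]
    funext y
    simp [metricFun]
  have : FiniteDimensional ℝ (E x) := VectorBundle.finiteDimensional ℝ F E x
  -- Orthogonality to s and Js is two linear conditions, so rank greater than two leaves a nonzero
  -- solution.
  obtain ⟨v, hv, hv0⟩ := Submodule.exists_mem_ne_zero_of_ne_bot
    (LinearMap.ker_ne_bot_of_finrank_lt (K := ℝ) (f := LinearMap.prod
      (g.inner x (s x) : E x →ₗ[ℝ] ℝ) (g.inner x (J.toFun x (s x)) : E x →ₗ[ℝ] ℝ)) (by simpa))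
  obtain ⟨t, rfl⟩ := exists_section (I := I) (F := F) x v
  obtain ⟨h1, h2⟩ := Prod.mk.inj hv
  replace h1 : metricFun g s t x = 0 := h1
  replace h2 : metricFun g (J.onSection s) t x = 0 := h2
  have h1' : metricFun g t s x = 0 := by rw [metricFun_comm, h1]
  have h2' : metricFun g t (J.onSection s) x = 0 := by rw [metricFun_comm, h2]
  have h3 : metricFun g s (J.onSection t) x = 0 := by
    rw [hK.metricFun_onSection_left, Pi.neg_apply, neg_eq_zero] at h2
    exact h2
  have h3' : metricFun g (J.onSection t) s x = 0 := by rw [metricFun_comm, h3]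
  -- In this instance the coefficient of ρ(s)f is the model on (t, Jt, t, Jt), namely 4 g(t,t)²,
  -- while those of ρ(t)f and ρ(Jt)f vanish at x by orthogonality.
  have hc := congrFun (hcyc s t (J.onSection t) (J.onSection t) t) x
  rw [hK.modelCurvature_holomorphic] at hc
  simp only [modelCurvature, Pi.add_apply, Pi.sub_apply, Pi.mul_apply, Pi.pow_apply,
    Pi.ofNat_apply, hK.hermitian, J.onSection_onSection, metricFun_neg_right,
    Pi.neg_apply, hK.metricFun_onSection_self, h1', h2', h3, h3'] at hc
  have hp := metricFun_self_pos (g := g) t hv0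
  have hc' : A.deriv s f x * (4 * metricFun g t t x ^ 2) = 0 := by linear_combination hc
  exact (mul_eq_zero.1 hc').resolve_right (by positivity)

/-- Schur's theorem for transitive Kählerian Lie algebroids of rank at least four. -/
theorem IsKahlerian.hasConstantHolomorphicCurvature [I.Boundaryless] [ConnectedSpace M]
    (hK : IsKahlerian A J g) (hA : A.IsTransitive) (hF : 2 < finrank ℝ F)
    (hpt : HasPointwiseConstantHolomorphicCurvature A J g) :
    HasConstantHolomorphicCurvature A J g := by
  have hk : ∀ x, ∃ c, ∀ P, J.IsInvariantPlane x P → A.sectionalCurvature g x P = c := fun x => by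
    by_cases h : ∃ P, J.IsInvariantPlane x P
    · obtain ⟨Q, hQ⟩ := h
      exact ⟨_, fun P hP => hpt x P Q hP hQ⟩
    -- With no invariant plane to test, any value would serve.
    · exact ⟨0, fun P hP => absurd ⟨P, hP⟩ h⟩
  choose k hk using hk
  have hE : ∀ x, 2 < finrank ℝ (E x) := fun x => by
    rwa [VectorBundle.finrank_eq ℝ F E x]
  have hsm := hK.contMDiff_curvatureFunction hk fun x =>
    Module.nontrivial_of_finrank_pos (R := ℝ) (by have := hE x; omega)
  have hsm' : ContMDiff I 𝓘(ℝ, ℝ) ∞ fun x => k x / 4 := hsm.div_const 4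
  have : IsManifold I 1 M := IsManifold.of_le (n := ∞) (by norm_cast)
  obtain ⟨c, hc⟩ := exists_eq_const_of_mvfderiv_eq_zero (hsm'.mdifferentiable (by simp))
    fun x => by
      ext v
      -- Transitivity enters only here: every tangent vector is an anchor image, so vanishing along
      -- the anchor is vanishing of the full differential.
      obtain ⟨w, rfl⟩ := hA x v
      obtain ⟨s, rfl⟩ := exists_section (I := I) (F := F) x w
      exact hK.deriv_eq_zero_of_riemann_eq hsm' (hK.riemann_eq_modelCurvature hk) (hE x) s
  refine ⟨4 * c, fun x P hP => ?_⟩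
  rw [hk x P hP, ← hc x]
  ring

end Schur

end LieAlgd

end

theorem theorem3p2 {n : ℕ} {M : Type*} [TopologicalSpace M]
    [ChartedSpace (EuclideanSpace ℝ (Fin n)) M] [IsManifold (𝓡 n) ∞ M]
    [T2Space M] [SecondCountableTopology M] [ConnectedSpace M]
    {F : Type*} [NormedAddCommGroup F] [NormedSpace ℝ F] [FiniteDimensional ℝ F]
    {E : M → Type*} [TopologicalSpace (TotalSpace F E)]
    [∀ x, AddCommGroup (E x)] [∀ x, Module ℝ (E x)] [∀ x, TopologicalSpace (E x)]
    [FiberBundle F E] [VectorBundle ℝ F E] [ContMDiffVectorBundle ∞ F E (𝓡 n)]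
    (A : LieAlgd.LieAlgebroid (𝓡 n) F E) (J : LieAlgd.AlmostComplexStructure F E (𝓡 n))
    (g : ContMDiffRiemannianMetric (𝓡 n) ∞ F E)
    (hK : LieAlgd.IsKahlerian A J g) (hA : A.IsTransitive)
    (m : ℕ) (hrank : Module.finrank ℝ F = 2 * m) (hm : 4 ≤ 2 * m)
    (hpt : LieAlgd.HasPointwiseConstantHolomorphicCurvature A J g) :
    LieAlgd.HasConstantHolomorphicCurvature A J g := by
  exact hK.hasConstantHolomorphicCurvature hA (by omega) hpt
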